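/- Let $k$ be an algebraically closed field and let $\mathcal C$ be a (not necessarily semisimple) modular tensor category over $k$. That is, $\mathcal C$ is a $k$-linear abelian category with finite-dimensional morphism spaces, with all objects of finite length, with enough projectives and with finitely many simple objects up to isomorphism. It is endowed with a rigid monoidal structure with $k$-bilinear tensor product, a braiding $\beta$ and a twist $\theta$ that make it a ribbon category. The unit $\mathbf 1$ is simple. Every object $x$ with $\beta_{y,x}\circ\beta_{x,y}=\mathrm{id}_{x\otimes y}$ for all $y$ is isomorphic to a finite direct sum of copies of $\mathbf 1$. Let $x^\vee$ be the right dual of $x$, with $\mathrm{ev}_x\colon x^\vee\otimes x\to\mathbf 1$ and $\mathrm{coev}_x\colon\mathbf 1\to x\otimes x^\vee$, and put $\widetilde{\mathrm{ev}}_x=\mathrm{ev}_x\circ\beta_{x,x^\vee}\circ(\theta_x\otimes\mathrm{id})\colon x\otimes x^\vee\to\mathbf 1$ and $\widetilde{\mathrm{coev}}_x=(\mathrm{id}\otimes\theta_x)\circ\beta_{x,x^\vee}\circ\mathrm{coev}_x\colon\mathbf 1\to x^\vee\otimes x$. Let $\pi_x=(\widetilde{\mathrm{ev}}_x\otimes\mathrm{id}_{x^{\vee\vee}})\circ(\mathrm{id}_x\otimes\mathrm{coev}_{x^\vee})\colon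 x\to x^{\vee\vee}$ be the resulting pivotal structure. Associators and unitors are suppressed, and canonical isomorphisms between different right duals of the same object are used without mention. Then the coend $L=\int^{x\in\mathcal C}x^\vee\otimes x$ exists. Let $L$ be such a coend, with dinatural family $\iota_x\colon x^\vee\otimes x\to L$, and define: * the unit $\eta=\iota_{\mathbf 1}\colon\mathbf 1\to L$ and the product $\mu\colon L\otimes L\to L$ determined by $\mu\circ(\iota_x\otimes\iota_y)=\iota_{y\otimes x}\circ(\mathrm{id}_{x^\vee}\otimes\beta_{x,\,y^\vee\otimes y})$; * the convolution product $\alpha*\alpha'=\mu\circ(\alpha\otimes\alpha')$ on $\mathrm{Hom}_{\mathcal C}(\mathbf 1,L)$; * for $m\in\mathcal C$ the canonical $L$-coaction $\delta_m=\bigl((\iota_{m^\vee}\circ(\pi_m\otimes\mathrm{id}_{m^\vee}))\otimes\mathrm{id}_m\bigr)\circ(\mathrm{id}_m\otimes\widetilde{\mathrm{coev}}_m)\colon m\to L\otimes m$, and the cocharacter $\widehat\chi_m=(\mathrm{id}_L\otimes\widetilde{\mathrm{ev}}_m)\circ(\delta_m\otimes\mathrm{id}_{m^\vee})\circ\mathrm{coev}_m\in\mathrm{Hom}_{\mathcal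 C}(\mathbf 1,L)$, which is the outgoing boundary state of the boundary condition $m$; * the object $F=(L,\gamma)$ of the Drinfeld center $\mathcal Z(\mathcal C)$, with half-braiding $\gamma_c\colon L\otimes c\to c\otimes L$ determined by $\gamma_c\circ(\iota_x\otimes\mathrm{id}_c)=(\mathrm{id}_c\otimes\iota_{x\otimes c})\circ(\mathrm{coev}_c\otimes\mathrm{id}_{x^\vee\otimes x\otimes c})$; this $F$ is the image of $\mathbf 1$ under the left adjoint of the forgetful functor $\mathcal Z(\mathcal C)\to\mathcal C$; * the mutually inverse bijections $\widetilde\varphi\colon\mathrm{Hom}_{\mathcal C}(\mathbf 1,L)\to\mathrm{End}_{\mathcal Z(\mathcal C)}(F)$, $\widetilde\varphi(\alpha)=\mu\circ(\mathrm{id}_L\otimes\alpha)$, and $\widetilde\psi(g)=g\circ\eta$; * the sewing of two outgoing boundary blocks through $\mathrm{End}_{\mathcal Z(\mathcal C)}(F)$, $\mathrm{sew}(\alpha,\alpha')=\widetilde\psi\bigl(\widetilde\varphi(\alpha')\circ\widetilde\varphi(\alpha)\bigr)$, and the annulus amplitude $\mathrm A_{mn}=\mathrm{sew}(\widehat\chi_m,\widehat\chi_n)$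 for boundary conditions $m,n\in\mathcal C$. The following holds. 1. $\mathrm{sew}(\alpha,\alpha')=\alpha*\alpha'$ for all $\alpha,\alpha'\in\mathrm{Hom}_{\mathcal C}(\mathbf 1,L)$. 2. $\mathrm A_{mn}=\widehat\chi_m*\widehat\chi_n=\widehat\chi_{m\otimes n}$ for all $m,n\in\mathcal C$. 3. Let $(S_l)_{l\in I}$ be a finite family that contains exactly one representative of each isomorphism class of simple objects. Then the classes $[S_l]$ form a $\mathbb Z$-basis of the Grothendieck ring $K_0(\mathcal C)$. For all $m,n\in\mathcal C$, the coefficients $N_{mn}^{\;\;\;l}$ in $[m]\,[n]=\sum_{l\in I}N_{mn}^{\;\;\;l}\,[S_l]$ are non-negative integers, and $$\mathrm A_{mn}=\sum_{l\in I}N_{mn}^{\;\;\;l}\,\widehat\chi_{S_l}.$$ 4. In particular, $\mathrm A_{mn}$ lies in the $k$-linear span of the cocharacters inside $\mathrm{Hom}_{\mathcal C}(\mathbf 1,L)$, for all $m,n\in\mathcal C$ (pseudo-cocharacters do not contribute). -/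

import Mathlib

open CategoryTheory CategoryTheory.Limits MonoidalCategory Opposite

namespace CardyCFT

universe v u

noncomputable section

section Pairings

variable {C : Type u} [Category.{v} C] [MonoidalCategory C]

theorem homEquiv_mate {x y z : C} [HasRightDual x] [HasRightDual y] (f : x ⟶ y)
    (g : xᘁ ⊗ x ⟶ z) :
    tensorLeftHomEquiv x y yᘁ z (fᘁ ▷ x ≫ g) = tensorLeftHomEquiv x x xᘁ z g ≫ f ▷ z := by
  simp only [tensorLeftHomEquiv, Equiv.coe_fn_mk]
  rw [MonoidalCategory.whiskerLeft_comp, ← associator_naturality_middle_assoc,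
    ← comp_whiskerRight_assoc, coevaluation_comp_rightAdjointMate]
  simp [whisker_exchange]

theorem homEquiv_natural_left {x x' y y' z : C} [ExactPairing y y'] (f : x ⟶ x')
    (g : y' ⊗ x' ⟶ z) :
    tensorLeftHomEquiv x y y' z (y' ◁ f ≫ g) = f ≫ tensorLeftHomEquiv x' y y' z g := by
  apply (tensorLeftHomEquiv x y y' z).symm.injective
  rw [tensorLeftHomEquiv_symm_naturality]; simp

/-- In a left rigid category a natural monoidal family `x ⊗ c ⟶ c ⊗ x` is invertible, hence a
half-braiding. -/
theorem lax_inv [LeftRigidCategory C] {x : C} (b : ∀ c : C, x ⊗ c ⟶ c ⊗ x)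
    (hb1 : b (𝟙_ C) = (ρ_ x).hom ≫ (λ_ x).inv)
    (hbt : ∀ c d : C, b (c ⊗ d) =
      (α_ _ _ _).inv ≫ b c ▷ d ≫ (α_ _ _ _).hom ≫ c ◁ b d ≫ (α_ _ _ _).inv)
    (hbn : ∀ {c d : C} (f : c ⟶ d), x ◁ f ≫ b d = b c ≫ f ▷ x) (c : C) : IsIso (b c) := by
  let e : 𝟙_ C ⟶ (ᘁc : C) ⊗ c := η_ (ᘁc : C) c
  let n : c ⊗ (ᘁc : C) ⟶ 𝟙_ C := ε_ (ᘁc : C) c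
  refine ⟨𝟙 _ ⊗≫ (c ⊗ x) ◁ e ⊗≫ c ◁ b (ᘁc : C) ▷ c ⊗≫ n ▷ (x ⊗ c) ⊗≫ 𝟙 _, ?_, ?_⟩
  · calc
      _ = 𝟙 _ ⊗≫ (b c ▷ (𝟙_ C) ≫ (c ⊗ x) ◁ e) ⊗≫ c ◁ b (ᘁc : C) ▷ c ⊗≫ n ▷ (x ⊗ c) ⊗≫ 𝟙 _ := by
        monoidal
      _ = 𝟙 _ ⊗≫ (x ⊗ c) ◁ e ⊗≫ ((α_ _ _ _).inv ≫ b c ▷ (ᘁc : C) ≫ (α_ _ _ _).hom ≫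
            c ◁ b (ᘁc : C) ≫ (α_ _ _ _).inv) ▷ c ⊗≫ n ▷ (x ⊗ c) ⊗≫ 𝟙 _ := by
        rw [← whisker_exchange]; monoidal
      _ = 𝟙 _ ⊗≫ (x ⊗ c) ◁ e ⊗≫ (b (c ⊗ (ᘁc : C)) ≫ n ▷ x) ▷ c ⊗≫ 𝟙 _ := by
        rw [← hbt]; monoidal
      _ = 𝟙 _ ⊗≫ x ◁ (c ◁ e ⊗≫ n ▷ c) ⊗≫ 𝟙 _ := by
        rw [← hbn, hb1]; monoidal
      _ = _ := by
        rw [ExactPairing.coevaluation_evaluation'']; monoidal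
  · calc
      _ = 𝟙 _ ⊗≫ (c ⊗ x) ◁ e ⊗≫ c ◁ b (ᘁc : C) ▷ c ⊗≫
            (n ▷ (x ⊗ c) ≫ (𝟙_ C) ◁ b c) ⊗≫ 𝟙 _ := by
        monoidal
      _ = 𝟙 _ ⊗≫ (c ⊗ x) ◁ e ⊗≫ c ◁ ((α_ _ _ _).inv ≫ b (ᘁc : C) ▷ c ≫ (α_ _ _ _).hom ≫
            (ᘁc : C) ◁ b c ≫ (α_ _ _ _).inv) ⊗≫ n ▷ (c ⊗ x) ⊗≫ 𝟙 _ := by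
        rw [← whisker_exchange]; monoidal
      _ = 𝟙 _ ⊗≫ c ◁ (x ◁ e ≫ b ((ᘁc : C) ⊗ c)) ⊗≫ n ▷ (c ⊗ x) ⊗≫ 𝟙 _ := by
        rw [← hbt]; monoidal
      _ = 𝟙 _ ⊗≫ (c ◁ e ⊗≫ n ▷ c) ▷ x ⊗≫ 𝟙 _ := by
        rw [hbn, hb1]; monoidal
      _ = _ := by
        rw [ExactPairing.coevaluation_evaluation'']; monoidal

end Pairings

theorem halfBraiding_unit {C : Type u} [Category.{v} C] [MonoidalCategory C] {X : C} (b : HalfBraiding X) :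
    (b.β (𝟙_ C)).hom = (ρ_ X).hom ≫ (λ_ X).inv := by
  have h : (b.β (𝟙_ C)).hom ≫ (λ_ X).hom = (ρ_ X).hom :=
    congrArg Center.Hom.f (braiding_leftUnitor (C := Center C) ⟨X, b⟩)
  rw [← h]; simp

section Rigid

variable {C : Type u} [Category.{v} C] [MonoidalCategory C] [RightRigidCategory C]

variable (C) in
/-- The bifunctor `(x, y) ↦ xᘁ ⊗ y`. A coend `L` of it is a cowedge `W` with `hW : IsColimit W`;
its underlying object is `W.pt`. -/
def dualTensor : Cᵒᵖ ⥤ C ⥤ C where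
  obj x := tensorLeft ((unop x)ᘁ)
  map f := (curriedTensor C).map (f.unopᘁ)
  map_id x := by
    ext y
    simp
  map_comp f g := by
    ext y
    simp [comp_rightAdjointMate]

variable {W : Cowedge (dualTensor C)}

/-- The component `xᘁ ⊗ x ⟶ L` of the dinatural family of a cowedge `L`. -/
def dinat (W : Cowedge (dualTensor C)) (x : C) : xᘁ ⊗ x ⟶ W.pt :=
  W.π x

/-- The dinatural family, written with an arbitrary right dual `y` of `x` in place of the chosen
one. -/
def dinatOf (W : Cowedge (dualTensor C)) (x y : C) [p : ExactPairing x y] : y ⊗ x ⟶ W.pt :=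
  (rightDualIso p (HasRightDual.exact (X := x))).hom ▷ x ≫ dinat W x

/-- The dinatural family transposed through duality, a natural family `x ⟶ x ⊗ L`. -/
def coact (W : Cowedge (dualTensor C)) (x : C) : x ⟶ x ⊗ W.pt :=
  tensorLeftHomEquiv x x xᘁ W.pt (dinat W x)

theorem dinat_naturality {x y : C} (f : x ⟶ y) :
    fᘁ ▷ x ≫ dinat W x = yᘁ ◁ f ≫ dinat W y :=
  Cowedge.condition W f

theorem coact_naturality {x y : C} (f : x ⟶ y) :
    f ≫ coact W y = coact W x ≫ f ▷ W.pt := by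
  rw [coact, coact, ← homEquiv_mate, dinat_naturality, homEquiv_natural_left]

theorem homEquiv_dinatOf (x y : C) [p : ExactPairing x y] :
    tensorLeftHomEquiv x x y W.pt (dinatOf W x y) = coact W x := by
  rw [dinatOf, coact]
  have := @homEquiv_mate C _ _ x x W.pt ⟨xᘁ⟩ ⟨y⟩ (𝟙 x) (dinat W x)
  rw [id_whiskerRight, Category.comp_id] at this
  exact this

theorem hom_ext_coact (hW : IsColimit W) {z : C} {f g : W.pt ⟶ z}
    (h : ∀ x : C, coact W x ≫ x ◁ f = coact W x ≫ x ◁ g) : f = g := by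
  refine Cowedge.IsColimit.hom_ext hW fun (x : C) => ?_
  apply (tensorLeftHomEquiv x x xᘁ z).injective
  have := h x
  rwa [coact, ← tensorLeftHomEquiv_naturality, ← tensorLeftHomEquiv_naturality] at this

theorem exists_of_natural (hW : IsColimit W) {z : C} (t : ∀ x, x ⟶ x ⊗ z)
    (ht : ∀ {x y : C} (f : x ⟶ y), f ≫ t y = t x ≫ f ▷ z) :
    ∃ g : W.pt ⟶ z, ∀ x, coact W x ≫ x ◁ g = t x := by
  refine ⟨Cowedge.IsColimit.desc hW (fun x => (tensorLeftHomEquiv x x xᘁ z).symm (t x)) ?_, ?_⟩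
  · intro x y f
    apply (tensorLeftHomEquiv x y yᘁ z).injective
    refine (homEquiv_mate f _).trans (Eq.trans ?_ (homEquiv_natural_left f _).symm)
    simp [ht]
  · intro x
    rw [coact, ← tensorLeftHomEquiv_naturality]
    apply (tensorLeftHomEquiv x x xᘁ z).symm.injective
    rw [Equiv.symm_apply_apply]
    exact Cowedge.IsColimit.π_desc hW _ _ x

theorem hom_ext_coact₂ (hW : IsColimit W) {c z : C} {f g : W.pt ⊗ c ⟶ z}
    (h : ∀ x : C, coact W x ▷ c ≫ (α_ _ _ _).hom ≫ x ◁ f =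
      coact W x ▷ c ≫ (α_ _ _ _).hom ≫ x ◁ g) : f = g := by
  apply (tensorRightHomEquiv W.pt c cᘁ z).injective
  refine hom_ext_coact hW fun x => ?_
  have key : ∀ f : W.pt ⊗ c ⟶ z, coact W x ≫ x ◁ (tensorRightHomEquiv W.pt c cᘁ z) f =
      tensorRightHomEquiv x c cᘁ (x ⊗ z) (coact W x ▷ c ≫ (α_ _ _ _).hom ≫ x ◁ f) ≫
        (α_ _ _ _).hom := by
    intro f
    simp only [tensorRightHomEquiv, Equiv.coe_fn_mk]
    calc
      _ = 𝟙 _ ⊗≫ (coact W x ▷ (𝟙_ C) ≫ (x ⊗ W.pt) ◁ η_ c cᘁ) ⊗≫ x ◁ f ▷ cᘁ ⊗≫ 𝟙 _ := by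
        monoidal
      _ = _ := by
        rw [← whisker_exchange]; monoidal
  rw [key, key, h]

theorem exists_of_natural₂ (hW : IsColimit W) {c z : C} (t : ∀ x, x ⊗ c ⟶ x ⊗ z)
    (ht : ∀ {x y : C} (f : x ⟶ y), f ▷ c ≫ t y = t x ≫ f ▷ z) :
    ∃ g : W.pt ⊗ c ⟶ z, ∀ x, coact W x ▷ c ≫ (α_ _ _ _).hom ≫ x ◁ g = t x := by
  obtain ⟨g, hg⟩ := exists_of_natural hW (z := z ⊗ cᘁ)
    (fun x => tensorRightHomEquiv x c cᘁ (x ⊗ z) (t x) ≫ (α_ _ _ _).hom) (by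
      intro x y f
      have h1 : f ≫ tensorRightHomEquiv y c cᘁ (y ⊗ z) (t y) =
          tensorRightHomEquiv x c cᘁ (x ⊗ z) (t x) ≫ f ▷ z ▷ cᘁ := by
        rw [← tensorRightHomEquiv_naturality, ← ht]
        apply (tensorRightHomEquiv x c cᘁ (y ⊗ z)).symm.injective
        rw [tensorRightHomEquiv_symm_naturality]; simp
      rw [reassoc_of% h1]
      simp)
  refine ⟨(tensorRightHomEquiv W.pt c cᘁ z).symm g, fun x => ?_⟩
  apply (tensorRightHomEquiv x c cᘁ (x ⊗ z)).injective
  rw [← cancel_mono (α_ x z cᘁ).hom, ← hg]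
  simp only [tensorRightHomEquiv, Equiv.coe_fn_mk, Equiv.coe_fn_symm_mk]
  calc
    _ = 𝟙 _ ⊗≫ x ◁ η_ c cᘁ ⊗≫ (coact W x ≫ x ◁ g) ▷ (c ⊗ cᘁ) ⊗≫
          (x ⊗ z) ◁ (ε_ c cᘁ ▷ cᘁ) ⊗≫ 𝟙 _ := by monoidal
    _ = 𝟙 _ ⊗≫ (x ◁ η_ c cᘁ ≫ (coact W x ≫ x ◁ g) ▷ (c ⊗ cᘁ)) ⊗≫
          (x ⊗ z) ◁ (ε_ c cᘁ ▷ cᘁ) ⊗≫ 𝟙 _ := by monoidal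
    _ = 𝟙 _ ⊗≫ (coact W x ≫ x ◁ g) ⊗≫ (x ⊗ z) ◁ (cᘁ ◁ η_ c cᘁ ⊗≫
          ε_ c cᘁ ▷ cᘁ) ⊗≫ 𝟙 _ := by
        rw [whisker_exchange]; monoidal
    _ = _ := by rw [ExactPairing.coevaluation_evaluation'']; monoidal

/-- The morphism `(xᘁ ⊗ x) ⊗ c ⟶ c ⊗ L` obtained by creating a pair `c ⊗ cᘁ` to the left and
applying the dinatural family at `x ⊗ c`. -/
def halfBraidingAux (W : Cowedge (dualTensor C)) (x c : C) : (xᘁ ⊗ x) ⊗ c ⟶ c ⊗ W.pt :=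
  𝟙 _ ⊗≫ η_ c cᘁ ▷ ((xᘁ ⊗ x) ⊗ c) ⊗≫ c ◁ dinatOf W (x ⊗ c) (cᘁ ⊗ xᘁ)

theorem homEquiv_halfBraidingAux (x c : C) :
    tensorLeftHomEquiv (x ⊗ c) x xᘁ (c ⊗ W.pt)
      ((α_ _ _ _).inv ≫ halfBraidingAux W x c) = coact W (x ⊗ c) ≫ (α_ _ _ _).hom := by
  rw [← homEquiv_dinatOf (x ⊗ c) (cᘁ ⊗ xᘁ)]
  simp only [tensorLeftHomEquiv, Equiv.coe_fn_mk, ExactPairing.tensor_coevaluation,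
    halfBraidingAux]
  calc
    _ = 𝟙 _ ⊗≫ η_ x xᘁ ▷ (x ⊗ c) ⊗≫ x ◁ η_ c cᘁ ▷ (xᘁ ⊗ x ⊗ c) ⊗≫
          (x ⊗ c) ◁ dinatOf W (x ⊗ c) (cᘁ ⊗ xᘁ) ⊗≫ 𝟙 _ := by monoidal
    _ = _ := by monoidal

theorem homEquiv_dinat_whisker {x c z : C} (g : W.pt ⊗ c ⟶ z) :
    tensorLeftHomEquiv (x ⊗ c) x xᘁ z ((α_ _ _ _).inv ≫ dinat W x ▷ c ≫ g) =
      coact W x ▷ c ≫ (α_ _ _ _).hom ≫ x ◁ g := by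
  rw [coact]
  simp only [tensorLeftHomEquiv, Equiv.coe_fn_mk]
  monoidal

theorem dinat_whisker_iff {x c z : C} (g : W.pt ⊗ c ⟶ z) (f : (xᘁ ⊗ x) ⊗ c ⟶ z) :
    dinat W x ▷ c ≫ g = f ↔ coact W x ▷ c ≫ (α_ _ _ _).hom ≫ x ◁ g =
      tensorLeftHomEquiv (x ⊗ c) x xᘁ z ((α_ _ _ _).inv ≫ f) := by
  rw [← homEquiv_dinat_whisker, Equiv.apply_eq_iff_eq, cancel_epi]

theorem halfBraidingMap_iff {x c : C} (g : W.pt ⊗ c ⟶ c ⊗ W.pt) :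
    dinat W x ▷ c ≫ g = halfBraidingAux W x c ↔
      coact W x ▷ c ≫ (α_ _ _ _).hom ≫ x ◁ g = coact W (x ⊗ c) ≫ (α_ _ _ _).hom := by
  rw [dinat_whisker_iff, homEquiv_halfBraidingAux]

theorem existsUnique_halfBraidingMap (hW : IsColimit W) (c : C) :
    ∃! g : W.pt ⊗ c ⟶ c ⊗ W.pt, ∀ x : C, dinat W x ▷ c ≫ g = halfBraidingAux W x c := by
  obtain ⟨g, hg⟩ := exists_of_natural₂ hW (c := c)
    (fun x => coact W (x ⊗ c) ≫ (α_ _ _ _).hom) (by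
      intro x y f
      rw [← Category.assoc, coact_naturality]
      simp)
  refine ⟨g, fun x => (halfBraidingMap_iff g).2 (hg x), fun g' hg' => ?_⟩
  refine hom_ext_coact₂ hW fun x => ?_
  rw [hg, (halfBraidingMap_iff g').1 (hg' x)]

/-- The half-braiding `γ_c : L ⊗ c ⟶ c ⊗ L`, the unique morphism with
`γ_c ∘ (ι_x ⊗ id_c) = (id_c ⊗ ι_{x ⊗ c}) ∘ (coev_c ⊗ id)`. -/
def halfBraidingMap (hW : IsColimit W) (c : C) : W.pt ⊗ c ⟶ c ⊗ W.pt :=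
  (existsUnique_halfBraidingMap hW c).choose

theorem halfBraidingMap_spec (hW : IsColimit W) (c x : C) :
    dinat W x ▷ c ≫ halfBraidingMap hW c = halfBraidingAux W x c :=
  (existsUnique_halfBraidingMap hW c).choose_spec.1 x

theorem coact_halfBraidingMap (hW : IsColimit W) (c x : C) :
    coact W x ▷ c ≫ (α_ _ _ _).hom ≫ x ◁ halfBraidingMap hW c =
      coact W (x ⊗ c) ≫ (α_ _ _ _).hom :=
  (halfBraidingMap_iff _).1 (halfBraidingMap_spec hW c x)

theorem halfBraidingMap_unit (hW : IsColimit W) :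
    halfBraidingMap hW (𝟙_ C) = (ρ_ _).hom ≫ (λ_ _).inv := by
  refine hom_ext_coact₂ hW fun x => ?_
  rw [coact_halfBraidingMap]
  have h := coact_naturality (W := W) (ρ_ x).inv
  rw [Iso.inv_comp_eq] at h
  rw [h]
  monoidal

theorem halfBraidingMap_naturality (hW : IsColimit W) {c d : C} (f : c ⟶ d) :
    W.pt ◁ f ≫ halfBraidingMap hW d = halfBraidingMap hW c ≫ f ▷ W.pt := by
  refine hom_ext_coact₂ hW fun x => ?_
  calc
    _ = x ◁ f ≫ (coact W x ▷ d ≫ (α_ _ _ _).hom ≫ x ◁ halfBraidingMap hW d) := by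
      rw [whisker_exchange_assoc]; simp
    _ = (coact W x ▷ c ≫ (α_ _ _ _).hom ≫ x ◁ halfBraidingMap hW c) ≫ x ◁ f ▷ W.pt := by
      rw [coact_halfBraidingMap, coact_halfBraidingMap, ← Category.assoc, coact_naturality]; simp
    _ = _ := by simp

theorem halfBraidingMap_tensor (hW : IsColimit W) (c d : C) :
    halfBraidingMap hW (c ⊗ d) = (α_ _ _ _).inv ≫ halfBraidingMap hW c ▷ d ≫
      (α_ _ _ _).hom ≫ c ◁ halfBraidingMap hW d ≫ (α_ _ _ _).inv := by
  refine hom_ext_coact₂ hW fun x => ?_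
  rw [coact_halfBraidingMap]
  symm
  calc
    _ = 𝟙 _ ⊗≫ (coact W x ▷ c ≫ (α_ _ _ _).hom ≫ x ◁ halfBraidingMap hW c) ▷ d ⊗≫
          (x ⊗ c) ◁ halfBraidingMap hW d ⊗≫ 𝟙 _ := by monoidal
    _ = 𝟙 _ ⊗≫ (coact W (x ⊗ c) ▷ d ≫ (α_ _ _ _).hom ≫ (x ⊗ c) ◁ halfBraidingMap hW d) ⊗≫
          𝟙 _ := by rw [coact_halfBraidingMap]; monoidal
    _ = (α_ x c d).inv ≫ coact W ((x ⊗ c) ⊗ d) ⊗≫ 𝟙 _ := by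
      rw [coact_halfBraidingMap]; monoidal
    _ = _ := by
      have h := coact_naturality (W := W) (α_ x c d).inv
      rw [monoidalComp, ← Category.assoc, h]
      monoidal

/-- The unit `η = ι_𝟙 : 𝟙 ⟶ L`, where `𝟙` serves as its own dual. -/
def unitL (W : Cowedge (dualTensor C)) : 𝟙_ C ⟶ W.pt :=
  (λ_ (𝟙_ C)).inv ≫ dinatOf W (𝟙_ C) (𝟙_ C)

theorem coact_unit : coact W (𝟙_ C) = unitL W ≫ (λ_ W.pt).inv := by
  rw [← homEquiv_dinatOf (𝟙_ C) (𝟙_ C), unitL]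
  simp only [tensorLeftHomEquiv, Equiv.coe_fn_mk]
  change (λ_ (𝟙_ C)).inv ≫ (ρ_ (𝟙_ C)).inv ▷ 𝟙_ C ≫ _ = _
  monoidal

theorem unitL_halfBraidingMap (hW : IsColimit W) (c : C) :
    (λ_ c).inv ≫ unitL W ▷ c ≫ halfBraidingMap hW c = coact W c := by
  have h := coact_halfBraidingMap hW c (𝟙_ C)
  have h2 := coact_naturality (W := W) (λ_ c).hom
  rw [coact_unit] at h
  calc
    _ = (λ_ c).inv ≫ ((unitL W ≫ (λ_ W.pt).inv) ▷ c ≫ (α_ _ _ _).hom ≫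
          𝟙_ C ◁ halfBraidingMap hW c) ⊗≫ 𝟙 _ := by monoidal
    _ = (λ_ c).inv ≫ (coact W (𝟙_ C ⊗ c) ≫ (λ_ c).hom ▷ W.pt) := by rw [h]; monoidal
    _ = _ := by rw [← h2]; simp

end Rigid

section Center

variable {C : Type u} [Category.{v} C] [MonoidalCategory C] [RigidCategory C]
variable {W : Cowedge (dualTensor C)} (hW : IsColimit W)

instance (c : C) : IsIso (halfBraidingMap hW c) :=
  lax_inv (halfBraidingMap hW) (halfBraidingMap_unit hW) (halfBraidingMap_tensor hW)
    (halfBraidingMap_naturality hW) c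

/-- The object `F = (L, γ)` of the Drinfeld center, the free object `I(𝟙)` on the unit. -/
def bulkObj : Center C :=
  ⟨W.pt,
    { β := fun c => asIso (halfBraidingMap hW c)
      monoidal := fun c d => halfBraidingMap_tensor hW c d
      naturality := fun f => halfBraidingMap_naturality hW f }⟩

theorem coact_center {X : C} (b : HalfBraiding X) (f : W.pt ⟶ X)
    (hf : ∀ c : C, f ▷ c ≫ (b.β c).hom = halfBraidingMap hW c ≫ c ◁ f) (x : C) :
    coact W x ≫ x ◁ f = (λ_ x).inv ≫ (unitL W ≫ f) ▷ x ≫ (b.β x).hom := by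
  rw [comp_whiskerRight, Category.assoc, hf, ← unitL_halfBraidingMap hW]
  simp

/-- A morphism `L ⟶ X` satisfying the formula is a morphism of the Drinfeld center. -/
theorem center_comm {X : C} (b : HalfBraiding X) (a : 𝟙_ C ⟶ X) (f : W.pt ⟶ X)
    (hf : ∀ x : C, coact W x ≫ x ◁ f = (λ_ x).inv ≫ a ▷ x ≫ (b.β x).hom) (c : C) :
    f ▷ c ≫ (b.β c).hom = halfBraidingMap hW c ≫ c ◁ f := by
  refine hom_ext_coact₂ hW fun x => ?_
  calc
    _ = (coact W x ≫ x ◁ f) ▷ c ⊗≫ x ◁ (b.β c).hom := by monoidal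
    _ = 𝟙 _ ⊗≫ a ▷ (x ⊗ c) ⊗≫ ((α_ _ _ _).inv ≫ (b.β x).hom ▷ c ≫ (α_ _ _ _).hom ≫
          x ◁ (b.β c).hom ≫ (α_ _ _ _).inv) ⊗≫ 𝟙 _ := by rw [hf]; monoidal
    _ = (λ_ _).inv ≫ a ▷ (x ⊗ c) ≫ (b.β (x ⊗ c)).hom ≫ (α_ _ _ _).hom := by
      rw [← HalfBraiding.monoidal]; monoidal
    _ = (coact W (x ⊗ c) ≫ (x ⊗ c) ◁ f) ≫ (α_ _ _ _).hom := by rw [hf]; simp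
    _ = (coact W x ▷ c ≫ (α_ _ _ _).hom ≫ x ◁ halfBraidingMap hW c) ≫ x ◁ c ◁ f := by
      rw [coact_halfBraidingMap]; simp
    _ = _ := by simp

theorem unitL_comp {X : C} (b : HalfBraiding X) (a : 𝟙_ C ⟶ X) (f : W.pt ⟶ X)
    (hf : ∀ x : C, coact W x ≫ x ◁ f = (λ_ x).inv ≫ a ▷ x ≫ (b.β x).hom) :
    unitL W ≫ f = a := by
  have h := hf (𝟙_ C)
  rw [coact_unit, halfBraiding_unit] at h
  have h5 : (unitL W ≫ f) ≫ (λ_ X).inv = a ≫ (λ_ X).inv := by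
    calc
      _ = (unitL W ≫ (λ_ _).inv) ≫ 𝟙_ C ◁ f := by simp
      _ = _ := by rw [h]; monoidal
  exact (cancel_mono _).1 h5

/-- `F` is the value at `𝟙` of the left adjoint `I` of the forgetful functor from the Drinfeld
center: every `𝟙 ⟶ M` in `C` extends uniquely along `η` to a morphism `F ⟶ M` in the center. -/
theorem existsUnique_center (M : Center C) (a : 𝟙_ C ⟶ M.1) :
    ∃! f : bulkObj hW ⟶ M, (show 𝟙_ C ⟶ M.1 from unitL W ≫ f.f) = a := by
  obtain ⟨X, b⟩ := M
  change 𝟙_ C ⟶ X at a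
  obtain ⟨f, hf⟩ := exists_of_natural hW (z := X)
    (fun x => (λ_ x).inv ≫ a ▷ x ≫ (b.β x).hom) (by
      intro x y f
      simp only [Category.assoc, ← HalfBraiding.naturality, leftUnitor_inv_naturality_assoc]
      rw [whisker_exchange_assoc])
  refine ⟨⟨f, fun c => center_comm hW b a f hf c⟩, unitL_comp b a f hf, fun g hg => ?_⟩
  refine Center.ext _ _ (hom_ext_coact hW fun x => ?_)
  have h1 := coact_center hW b g.f (fun c => g.comm c) x
  refine h1.trans (Eq.trans ?_ (hf x).symm)
  rw [show unitL W ≫ g.f = a from hg]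

theorem hom_ext_dinat₂ (hW : IsColimit W) {z : C} {f g : W.pt ⊗ W.pt ⟶ z}
    (h : ∀ x y : C, (dinat W x ⊗ₘ dinat W y) ≫ f = (dinat W x ⊗ₘ dinat W y) ≫ g) : f = g := by
  refine hom_ext_coact₂ hW fun x => ?_
  rw [← homEquiv_dinat_whisker, ← homEquiv_dinat_whisker]
  congr 2
  apply (tensorLeftHomEquiv W.pt (HasLeftDual.leftDual ((xᘁ : C) ⊗ x)) ((xᘁ : C) ⊗ x) z).injective
  refine Cowedge.IsColimit.hom_ext hW fun (y : C) => ?_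
  change dinat W y ≫ _ = dinat W y ≫ _
  rw [← homEquiv_natural_left, ← homEquiv_natural_left]
  have := h x y
  rw [tensorHom_def', Category.assoc, Category.assoc] at this
  rw [this]

end Center

section Braided

variable {C : Type u} [Category.{v} C] [MonoidalCategory C] [RigidCategory C] [BraidedCategory C]
variable {W : Cowedge (dualTensor C)}

/-- The morphism `(xᘁ ⊗ x) ⊗ (yᘁ ⊗ y) ⟶ L` given by braiding `x` past `yᘁ ⊗ y` and then applying
the dinatural family at `y ⊗ x`, whose dual is `xᘁ ⊗ yᘁ`. -/
def mulAux (W : Cowedge (dualTensor C)) (x y : C) : (xᘁ ⊗ x) ⊗ (yᘁ ⊗ y) ⟶ W.pt :=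
  𝟙 _ ⊗≫ (xᘁ : C) ◁ (β_ x ((yᘁ : C) ⊗ y)).hom ⊗≫ dinatOf W (y ⊗ x) ((xᘁ : C) ⊗ (yᘁ : C))

theorem mulAux_eq (hW : IsColimit W) (x y : C) :
    mulAux W x y = ((xᘁ : C) ⊗ x) ◁ dinat W y ≫ (α_ _ _ _).hom ≫
      (tensorLeftHomEquiv (x ⊗ W.pt) x xᘁ W.pt).symm
        ((β_ x W.pt).hom ≫ halfBraidingMap hW x) := by
  rw [mulAux]
  simp only [tensorLeftHomEquiv, Equiv.coe_fn_symm_mk]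
  symm
  calc
    _ = 𝟙 _ ⊗≫ (xᘁ : C) ◁ ((x ◁ dinat W y ≫ (β_ x W.pt).hom) ≫ halfBraidingMap hW x) ⊗≫
          ε_ x xᘁ ▷ W.pt ⊗≫ 𝟙 _ := by monoidal
    _ = 𝟙 _ ⊗≫ (xᘁ : C) ◁ ((β_ x ((yᘁ : C) ⊗ y)).hom ≫ halfBraidingAux W y x) ⊗≫
          ε_ x xᘁ ▷ W.pt ⊗≫ 𝟙 _ := by
      rw [BraidedCategory.braiding_naturality_right, Category.assoc, halfBraidingMap_spec]
    _ = 𝟙 _ ⊗≫ (xᘁ : C) ◁ (β_ x ((yᘁ : C) ⊗ y)).hom ⊗≫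
          (xᘁ : C) ◁ (η_ x xᘁ ▷ (((yᘁ : C) ⊗ y) ⊗ x)) ⊗≫
          (((xᘁ : C) ⊗ x) ◁ dinatOf W (y ⊗ x) ((xᘁ : C) ⊗ (yᘁ : C)) ≫ ε_ x xᘁ ▷ W.pt) ⊗≫
          𝟙 _ := by
      rw [halfBraidingAux]; monoidal
    _ = 𝟙 _ ⊗≫ (xᘁ : C) ◁ (β_ x ((yᘁ : C) ⊗ y)).hom ⊗≫
          ((xᘁ : C) ◁ η_ x xᘁ ⊗≫ ε_ x xᘁ ▷ (xᘁ : C)) ▷ (((yᘁ : C) ⊗ y) ⊗ x) ⊗≫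
          dinatOf W (y ⊗ x) ((xᘁ : C) ⊗ (yᘁ : C)) := by
      rw [whisker_exchange]; monoidal
    _ = _ := by rw [ExactPairing.coevaluation_evaluation'']; monoidal

theorem exists_mul (hW : IsColimit W) : ∃ m : W.pt ⊗ W.pt ⟶ W.pt,
    (∀ x : C, coact W x ▷ W.pt ≫ (α_ _ _ _).hom ≫ x ◁ m =
      (β_ x W.pt).hom ≫ halfBraidingMap hW x) ∧
    ∀ x y : C, (dinat W x ⊗ₘ dinat W y) ≫ m = mulAux W x y := by
  obtain ⟨m, hm⟩ := exists_of_natural₂ hW (c := W.pt)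
    (fun x => (β_ x W.pt).hom ≫ halfBraidingMap hW x) (by
      intro x y f
      rw [BraidedCategory.braiding_naturality_left_assoc, halfBraidingMap_naturality]
      simp)
  refine ⟨m, hm, fun x y => ?_⟩
  rw [mulAux_eq hW, tensorHom_def', Category.assoc]
  congr 1
  have h := homEquiv_dinat_whisker (W := W) (x := x) (c := W.pt) m
  rw [hm] at h
  rw [← h]
  simp

theorem existsUnique_mul (hW : IsColimit W) :
    ∃! m : W.pt ⊗ W.pt ⟶ W.pt, ∀ x y : C, (dinat W x ⊗ₘ dinat W y) ≫ m = mulAux W x y := by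
  obtain ⟨m, -, hm⟩ := exists_mul hW
  exact ⟨m, hm, fun m' hm' => hom_ext_dinat₂ hW fun x y => by rw [hm, hm']⟩

/-- The product `μ : L ⊗ L ⟶ L`, the unique morphism with
`μ ∘ (ι_x ⊗ ι_y) = ι_{y ⊗ x} ∘ (id ⊗ β_{x, yᘁ ⊗ y})`. -/
def mulL (hW : IsColimit W) : W.pt ⊗ W.pt ⟶ W.pt :=
  (existsUnique_mul hW).choose

theorem mulL_spec (hW : IsColimit W) (x y : C) :
    (dinat W x ⊗ₘ dinat W y) ≫ mulL hW = mulAux W x y :=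
  (existsUnique_mul hW).choose_spec.1 x y

theorem coact_mulL (hW : IsColimit W) (x : C) :
    coact W x ▷ W.pt ≫ (α_ _ _ _).hom ≫ x ◁ mulL hW =
      (β_ x W.pt).hom ≫ halfBraidingMap hW x := by
  obtain ⟨m, hm, hm'⟩ := exists_mul hW
  have : mulL hW = m := hom_ext_dinat₂ hW fun x y => by rw [mulL_spec, hm']
  rw [this, hm]

/-- The morphism `μ ∘ (id ⊗ a) : L ⟶ L`. -/
def rightMul (hW : IsColimit W) (a : 𝟙_ C ⟶ W.pt) : W.pt ⟶ W.pt :=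
  (ρ_ W.pt).inv ≫ W.pt ◁ a ≫ mulL hW

theorem coact_rightMul (hW : IsColimit W) (a : 𝟙_ C ⟶ W.pt) (x : C) :
    coact W x ≫ x ◁ rightMul hW a = (λ_ x).inv ≫ a ▷ x ≫ halfBraidingMap hW x := by
  calc
    _ = (ρ_ x).inv ≫ (coact W x ▷ 𝟙_ C ≫ (x ⊗ W.pt) ◁ a) ⊗≫ x ◁ mulL hW := by
      rw [rightMul]; monoidal
    _ = (ρ_ x).inv ≫ x ◁ a ≫ (coact W x ▷ W.pt ≫ (α_ _ _ _).hom ≫ x ◁ mulL hW) := by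
      rw [← whisker_exchange]; monoidal
    _ = (ρ_ x).inv ≫ (x ◁ a ≫ (β_ x W.pt).hom) ≫ halfBraidingMap hW x := by
      rw [coact_mulL]; simp
    _ = _ := by
      rw [BraidedCategory.braiding_naturality_right]; simp

/-- The mutually inverse bijections `a ↦ μ ∘ (id ⊗ a)` and `g ↦ g ∘ η` between `Hom(𝟙, L)` and
the endomorphisms of `F` in the Drinfeld center. -/
def blockEquiv (hW : IsColimit W) : (𝟙_ C ⟶ W.pt) ≃ (bulkObj hW ⟶ bulkObj hW) where
  toFun a :=
    { f := rightMul hW a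
      comm := fun c => center_comm hW (bulkObj hW).2 a (rightMul hW a)
        (fun x => coact_rightMul hW a x) c }
  invFun g := unitL W ≫ g.f
  left_inv a := unitL_comp (bulkObj hW).2 a (rightMul hW a) (fun x => coact_rightMul hW a x)
  right_inv g := by
    refine Center.ext _ _ (hom_ext_coact hW fun x => ?_)
    have h1 := coact_center hW (bulkObj hW).2 g.f (fun c => g.comm c) x
    exact (coact_rightMul hW _ x).trans h1.symm

end Braided

section Ribbon

variable (C : Type u) [Category.{v} C] [MonoidalCategory C] [RigidCategory C] [BraidedCategory C]

/-- A ribbon structure on a braided rigid monoidal category: a natural twist compatible with the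
tensor product and the duality. -/
class RibbonCategory where
  /-- The twist `θ_x`. -/
  twist : ∀ x : C, x ≅ x
  twist_naturality : ∀ {x y : C} (f : x ⟶ y), f ≫ (twist y).hom = (twist x).hom ≫ f
  twist_tensor : ∀ x y : C, (twist (x ⊗ y)).hom =
    ((twist x).hom ⊗ₘ (twist y).hom) ≫ (β_ x y).hom ≫ (β_ y x).hom
  twist_dual : ∀ x : C, (twist (xᘁ : C)).hom = rightAdjointMate (twist x).hom

variable {C} [RibbonCategory C]

/-- The left evaluation `x ⊗ xᘁ ⟶ 𝟙`, obtained from the right duality, the braiding and the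
twist. -/
def leftEv (x : C) : x ⊗ (xᘁ : C) ⟶ 𝟙_ C :=
  (RibbonCategory.twist x).hom ▷ (xᘁ : C) ≫ (β_ x (xᘁ : C)).hom ≫ ε_ x (xᘁ : C)

/-- The left coevaluation `𝟙 ⟶ xᘁ ⊗ x`, obtained from the right duality, the braiding and the
twist. -/
def leftCoev (x : C) : 𝟙_ C ⟶ (xᘁ : C) ⊗ x :=
  η_ x (xᘁ : C) ≫ (β_ x (xᘁ : C)).hom ≫ (xᘁ : C) ◁ (RibbonCategory.twist x).hom

/-- The pivotal structure `x ⟶ xᘁᘁ`, identifying an object with its double dual. -/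
def pivotal (x : C) : x ⟶ ((xᘁ : C)ᘁ : C) :=
  (ρ_ x).inv ≫ x ◁ η_ (xᘁ : C) ((xᘁ : C)ᘁ : C) ≫ (α_ _ _ _).inv ≫
    leftEv x ▷ ((xᘁ : C)ᘁ : C) ≫ (λ_ _).hom

variable (W : Cowedge (dualTensor C))

/-- The canonical coaction `m ⟶ L ⊗ m`: create `mᘁ ⊗ m` to the right of `m` and apply the
dinatural family at `mᘁ`. -/
def coaction (m : C) : m ⟶ W.pt ⊗ m :=
  (ρ_ m).inv ≫ m ◁ leftCoev m ≫ (α_ _ _ _).inv ≫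
    (pivotal m ▷ (mᘁ : C) ≫ dinat W (mᘁ : C)) ▷ m

/-- The cocharacter `𝟙 ⟶ L` of the `L`-comodule `m`: the partial trace of its coaction. -/
def cocharacter (m : C) : 𝟙_ C ⟶ W.pt :=
  η_ m (mᘁ : C) ≫ coaction W m ▷ (mᘁ : C) ≫ (α_ _ _ _).hom ≫ W.pt ◁ leftEv m ≫ (ρ_ _).hom

variable {W}

/-- The convolution product on `Hom(𝟙, L)`. -/
def convolution (hW : IsColimit W) (a b : 𝟙_ C ⟶ W.pt) : 𝟙_ C ⟶ W.pt :=
  (λ_ (𝟙_ C)).inv ≫ (a ⊗ₘ b) ≫ mulL hW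

/-- Sewing of two outgoing boundary blocks through `End(F)`: both are turned into endomorphisms
of `F`, these are composed, and the composite is turned back into a block. -/
def sew (hW : IsColimit W) (a b : 𝟙_ C ⟶ W.pt) : 𝟙_ C ⟶ W.pt :=
  (blockEquiv hW).symm (blockEquiv hW a ≫ blockEquiv hW b)

/-- The annulus amplitude `A_mn`: the sewing of the outgoing boundary states of the boundary
conditions `m` and `n`, which are the cocharacters of `m` and `n`. -/
def annulusAmplitude (hW : IsColimit W) (m n : C) : 𝟙_ C ⟶ W.pt :=
  sew hW (cocharacter W m) (cocharacter W n)

end Ribbon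

section Finite

/-- Finite abelian categories over a field: finite-dimensional morphism spaces, objects of finite
length, enough projectives, finitely many simple objects up to isomorphism. -/
class FiniteLinearCategory (k : Type*) [Field k] (C : Type u) [Category.{v} C] [Abelian C]
    [Linear k C] : Prop where
  finiteDimensional_hom : ∀ X Y : C, FiniteDimensional k (X ⟶ Y)
  isNoetherianObject : ∀ X : C, IsNoetherianObject X
  isArtinianObject : ∀ X : C, IsArtinianObject X
  enoughProjectives : EnoughProjectives C
  finite_simples : ∃ (n : ℕ) (S : Fin n → C), ∀ X : C, Simple X → ∃ i, Nonempty (X ≅ S i)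

/-- Modular tensor categories, not necessarily semisimple: finite ribbon categories with simple
unit, in which every transparent object (trivial double braiding with all objects) is a finite
direct sum of copies of the unit. -/
class ModularTensorCategory (k : Type*) [Field k] (C : Type u) [Category.{v} C] [Abelian C]
    [Linear k C] [MonoidalCategory C] [MonoidalPreadditive C] [MonoidalLinear k C]
    [RigidCategory C] [BraidedCategory C] [RibbonCategory C] : Prop
    extends FiniteLinearCategory k C where
  simple_unit : Simple (𝟙_ C)
  transparent : ∀ X : C, (∀ Y : C, (β_ X Y).hom ≫ (β_ Y X).hom = 𝟙 (X ⊗ Y)) →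
    ∃ (n : ℕ) (b : Bicone fun _ : Fin n => 𝟙_ C), Nonempty b.IsBilimit ∧ Nonempty (X ≅ b.pt)

/-- `S` represents each isomorphism class of simple objects exactly once. -/
structure IsSimpleSystem {C : Type u} [Category.{v} C] [Abelian C] {I : Type*} (S : I → C) :
    Prop where
  simple : ∀ i, Simple (S i)
  existsUnique_iso : ∀ X : C, Simple X → ∃! i, Nonempty (X ≅ S i)

end Finite

section K0

open ZeroObject

variable (C : Type u) [Category.{v} C] [Abelian C]

/-- The subgroup of relations `[S₂] = [S₁] + [S₃]`. -/
def k0Relations : AddSubgroup (FreeAbelianGroup C) :=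
  AddSubgroup.closure {z | ∃ S : ShortComplex C, S.ShortExact ∧
    z = FreeAbelianGroup.of S.X₂ - (FreeAbelianGroup.of S.X₁ + FreeAbelianGroup.of S.X₃)}

/-- The Grothendieck group of an abelian category. -/
def K0 : Type u := FreeAbelianGroup C ⧸ k0Relations C

instance : AddCommGroup (K0 C) :=
  inferInstanceAs (AddCommGroup (FreeAbelianGroup C ⧸ k0Relations C))

variable {C}

/-- The class `[X]` of an object. -/
def K0.of (X : C) : K0 C := QuotientAddGroup.mk' (k0Relations C) (FreeAbelianGroup.of X)

theorem K0.of_shortExact {S : ShortComplex C} (hS : S.ShortExact) :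
    K0.of S.X₂ = K0.of S.X₁ + K0.of S.X₃ := by
  rw [← sub_eq_zero]
  exact (QuotientAddGroup.eq_zero_iff _).2 (AddSubgroup.subset_closure ⟨S, hS, rfl⟩)

/-- The homomorphism out of the Grothendieck group given by a function which is additive on short
exact sequences. -/
def K0.lift {A : Type*} [AddCommGroup A] (f : C → A)
    (hf : ∀ S : ShortComplex C, S.ShortExact → f S.X₂ = f S.X₁ + f S.X₃) : K0 C →+ A :=
  QuotientAddGroup.lift (k0Relations C) (FreeAbelianGroup.lift f) (by
    rw [k0Relations, AddSubgroup.closure_le]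
    rintro _ ⟨S, hS, rfl⟩
    simp [hf S hS])

theorem K0.lift_of {A : Type*} [AddCommGroup A] (f : C → A)
    (hf : ∀ S : ShortComplex C, S.ShortExact → f S.X₂ = f S.X₁ + f S.X₃) (X : C) :
    K0.lift f hf (K0.of X) = f X :=
  FreeAbelianGroup.lift_apply_of f X

theorem K0.hom_ext {A : Type*} [AddCommGroup A] {f g : K0 C →+ A}
    (h : ∀ X : C, f (K0.of X) = g (K0.of X)) : f = g := by
  apply QuotientAddGroup.addMonoidHom_ext
  ext X
  exact h X

theorem K0.of_iso {X Y : C} (e : X ≅ Y) : K0.of X = K0.of Y := by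
  have h0 : K0.of (0 : C) = 0 := by
    have := K0.of_shortExact (S := ShortComplex.mk (0 : (0 : C) ⟶ 0) (0 : (0 : C) ⟶ 0) (by simp))
      { exact := ShortComplex.exact_of_isZero_X₂ _ (isZero_zero C)
        mono_f := (isZero_zero C).mono _
        epi_g := (isZero_zero C).epi _ }
    simpa using this
  have := K0.of_shortExact (S := ShortComplex.mk e.hom (0 : Y ⟶ (0 : C)) (by simp))
    { exact := (ShortComplex.exact_iff_epi _ rfl).2 (show Epi e.hom from inferInstance)
      mono_f := show Mono e.hom from inferInstance
      epi_g := (isZero_zero C).epi _ }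
  simpa [h0] using this.symm

variable [MonoidalCategory C] [MonoidalPreadditive C] [RigidCategory C]

theorem shortExact_tensorLeft (X : C) {S : ShortComplex C} (hS : S.ShortExact) :
    (S.map (tensorLeft X)).ShortExact := by
  have := (tensorLeftAdjunction X (HasRightDual.rightDual X)).rightAdjoint_preservesLimits
  have := (tensorLeftAdjunction (HasLeftDual.leftDual X) X).leftAdjoint_preservesColimits
  exact hS.map_of_exact (tensorLeft X)

theorem shortExact_tensorRight (X : C) {S : ShortComplex C} (hS : S.ShortExact) :
    (S.map (tensorRight X)).ShortExact := by
  have := (tensorRightAdjunction X (HasRightDual.rightDual X)).leftAdjoint_preservesColimits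
  have := (tensorRightAdjunction (HasLeftDual.leftDual X) X).rightAdjoint_preservesLimits
  exact hS.map_of_exact (tensorRight X)

theorem K0.of_tensor_left (X : C) (S : ShortComplex C) (hS : S.ShortExact) :
    K0.of (X ⊗ S.X₂) = K0.of (X ⊗ S.X₁) + K0.of (X ⊗ S.X₃) :=
  K0.of_shortExact (shortExact_tensorLeft X hS)

theorem K0.of_tensor_right (Y : C) (S : ShortComplex C) (hS : S.ShortExact) :
    K0.of (S.X₂ ⊗ Y) = K0.of (S.X₁ ⊗ Y) + K0.of (S.X₃ ⊗ Y) :=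
  K0.of_shortExact (shortExact_tensorRight Y hS)

/-- Multiplication by the class of an object on the left, `[Y] ↦ [X ⊗ Y]`. -/
def K0.mulLeft (X : C) : K0 C →+ K0 C :=
  K0.lift (fun Y => K0.of (X ⊗ Y)) (K0.of_tensor_left X)

theorem K0.mulLeft_of (X Y : C) : K0.mulLeft X (K0.of Y) = K0.of (X ⊗ Y) :=
  K0.lift_of _ (K0.of_tensor_left X) Y

theorem K0.mulLeft_shortExact (S : ShortComplex C) (hS : S.ShortExact) :
    K0.mulLeft S.X₂ = K0.mulLeft S.X₁ + K0.mulLeft S.X₃ :=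
  K0.hom_ext fun Y => by
    rw [AddMonoidHom.add_apply, K0.mulLeft_of, K0.mulLeft_of, K0.mulLeft_of]
    exact K0.of_tensor_right Y S hS

/-- The product on the Grothendieck group, `[X] [Y] = [X ⊗ Y]`. -/
def K0.mulHom : K0 C →+ K0 C →+ K0 C :=
  K0.lift K0.mulLeft K0.mulLeft_shortExact

theorem K0.mulHom_of (X Y : C) : K0.mulHom (K0.of X) (K0.of Y) = K0.of (X ⊗ Y) := by
  rw [K0.mulHom, K0.lift_of, K0.mulLeft_of]

instance : Mul (K0 C) := ⟨fun a b => K0.mulHom a b⟩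

instance : One (K0 C) := ⟨K0.of (𝟙_ C)⟩

theorem K0.of_mul_of (X Y : C) : K0.of X * K0.of Y = K0.of (X ⊗ Y) := by
  exact K0.mulHom_of X Y

/-- The Grothendieck ring of an abelian rigid monoidal category. -/
instance : Ring (K0 C) :=
  { (inferInstance : AddCommGroup (K0 C)) with
    mul := (· * ·)
    one := 1
    left_distrib := fun a b c => map_add (K0.mulHom a) b c
    right_distrib := fun a b c => by
      change K0.mulHom (a + b) c = K0.mulHom a c + K0.mulHom b c
      rw [map_add, AddMonoidHom.add_apply]
    zero_mul := fun a => by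
      change K0.mulHom 0 a = 0
      rw [map_zero, AddMonoidHom.zero_apply]
    mul_zero := fun a => map_zero (K0.mulHom a)
    mul_assoc := fun a b c => by
      have h : ∀ X Y : C, (K0.mulHom (K0.of (X ⊗ Y)) : K0 C →+ K0 C) =
          (K0.mulHom (K0.of X)).comp (K0.mulHom (K0.of Y)) := fun X Y => K0.hom_ext fun Z => by
        rw [AddMonoidHom.comp_apply, K0.mulHom_of, K0.mulHom_of, K0.mulHom_of]
        exact K0.of_iso (α_ X Y Z)
      have h' : ∀ X : C, (K0.mulHom (C := C)).comp (K0.mulHom (K0.of X)) =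
          (AddMonoidHom.compHom (K0.mulHom (K0.of X))).comp K0.mulHom := fun X =>
        K0.hom_ext fun Y => by
          rw [AddMonoidHom.comp_apply, K0.mulHom_of]
          exact h X Y
      have h'' : (AddMonoidHom.compHom (K0.mulHom (C := C))).comp K0.mulHom =
          (AddMonoidHom.compHom.flip (K0.mulHom (C := C))).comp
            (AddMonoidHom.compHom.comp K0.mulHom) := K0.hom_ext fun X => h' X
      exact DFunLike.congr_fun (DFunLike.congr_fun (DFunLike.congr_fun h'' a) b) c
    one_mul := fun a => by
      have : K0.mulHom (K0.of (𝟙_ C)) = AddMonoidHom.id (K0 C) := K0.hom_ext fun X => by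
        rw [K0.mulHom_of]
        exact K0.of_iso (λ_ X)
      exact DFunLike.congr_fun this a
    mul_one := fun a => by
      have : (K0.mulHom (C := C)).flip (K0.of (𝟙_ C)) = AddMonoidHom.id (K0 C) :=
        K0.hom_ext fun X => by
          rw [AddMonoidHom.flip_apply, K0.mulHom_of]
          exact K0.of_iso (ρ_ X)
      exact DFunLike.congr_fun this a }

end K0

end
end CardyCFT

namespace CardyCFT

universe v u

/-! ### Dual pairings and the dinatural family at arbitrary duals -/

section Pairings

variable {C : Type u} [Category.{v} C] [MonoidalCategory C]

/-! Through duality, a morphism from `L` to `z` is a natural family `x ⟶ x ⊗ z`. The universal such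
family `coact` does not depend on the choice of duals, so identities about `L` reduce to string
diagrams in which convenient duals may be used.

Sewing: the endomorphism of `F` attached to `a` sends the unit `η` back to `a`, so composing two of
them and evaluating at `η` multiplies the blocks.

Multiplicativity: by a zigzag, `cocharacter W m` is the coevaluation of `m` followed by the
dinatural map at `mᘁ`, with `m` serving as right dual of `mᘁ` through the left (co)evaluation
(`cocharacter_eq`). By `convolution_dinatOf` the product of two such blocks is the nested
coevaluation followed by the dinatural map at `nᘁ ⊗ mᘁ`. This is the cocharacter of `m ⊗ n`, because
left evaluations are compatible with tensor products: the double braiding in the twist of `m ⊗ n`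
untangles (`double_braiding_evaluation`, `tensor_leftEv`).

Fusion coefficients: cocharacters are additive on short exact sequences, by dinaturality alone and
without any splitting (`cocharacter_shortExact`). They therefore define a homomorphism on the
Grothendieck group, which carries the decomposition of `[m ⊗ n]` into simple classes to that of the
amplitude. Simple classes span by removing simple subobjects one at a time; they are independent
because the functions `dim Hom(Q, -)`, for `Q` the projective covers of the simples, are dual to
them.

Existence of the coend: with `P` a projective separator, everything is determined at `P`, and `L` is
the quotient of `Pᘁ ⊗ P` by the dinaturality relations of the endomorphisms of `P`. -/

/-- The zigzag identities make the coevaluation a function of the evaluation, so compatibility with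
one gives compatibility with the other. -/
theorem ExactPairing.coevaluation_comp_of_comp_evaluation {x x' y : C} [ExactPairing x y]
    [ExactPairing x' y] (f : x ⟶ x') (hf : y ◁ f ≫ ε_ x' y = ε_ x y) :
    η_ x y ≫ f ▷ y = η_ x' y := by
  symm
  calc
    _ = η_ x' y ⊗≫ x' ◁ (y ◁ η_ x y ⊗≫ ε_ x y ▷ y) ⊗≫ 𝟙 _ := by
      rw [ExactPairing.coevaluation_evaluation'']; monoidal
    _ = 𝟙 _ ⊗≫ (η_ x' y ▷ 𝟙_ C ≫ (x' ⊗ y) ◁ (η_ x y ≫ f ▷ y)) ⊗≫ x' ◁ ε_ x' y ▷ y ⊗≫ 𝟙 _ := by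
      rw [← hf]; monoidal
    _ = 𝟙 _ ⊗≫ (η_ x y ≫ f ▷ y) ⊗≫ (η_ x' y ▷ x' ⊗≫ x' ◁ ε_ x' y) ▷ y ⊗≫ 𝟙 _ := by
      rw [← whisker_exchange]; monoidal
    _ = _ := by rw [ExactPairing.evaluation_coevaluation'']; monoidal

variable [RightRigidCategory C] {W : Cowedge (dualTensor C)}

theorem whiskerLeft_dinatOf {x x' y : C} [ExactPairing x y] [ExactPairing x' y] (f : x ⟶ x')
    [IsIso f] (hf : η_ x y ≫ f ▷ y = η_ x' y) : y ◁ f ≫ dinatOf W x' y = dinatOf W x y := by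
  apply (tensorLeftHomEquiv x x y W.pt).injective
  rw [homEquiv_dinatOf, ← cancel_mono (f ▷ W.pt), ← coact_naturality, homEquiv_natural_left,
    Category.assoc]
  congr 1
  rw [← homEquiv_dinatOf x' y]
  simp only [tensorLeftHomEquiv, Equiv.coe_fn_mk, ← hf]
  calc
    _ = 𝟙 _ ⊗≫ η_ x y ▷ x' ⊗≫ (x ◁ dinatOf W x' y ≫ f ▷ W.pt) := by monoidal
    _ = _ := by rw [whisker_exchange]; monoidal

/-- Both sides transpose to `coact W (x ⊗ c)`, which involves no choice of duals; so the defining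
formula of the half-braiding is available for every choice. -/
theorem dinatOf_halfBraidingMap (hW : IsColimit W) (x x' c c' : C) [ExactPairing x x']
    [ExactPairing c c'] : dinatOf W x x' ▷ c ≫ halfBraidingMap hW c =
      𝟙 _ ⊗≫ η_ c c' ▷ ((x' ⊗ x) ⊗ c) ⊗≫ c ◁ dinatOf W (x ⊗ c) (c' ⊗ x') := by
  rw [← cancel_epi (α_ x' x c).inv]
  apply (tensorLeftHomEquiv (x ⊗ c) x x' (c ⊗ W.pt)).injective
  trans coact W (x ⊗ c) ≫ (α_ _ _ _).hom
  · rw [← coact_halfBraidingMap hW, ← homEquiv_dinatOf x x']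
    simp only [tensorLeftHomEquiv, Equiv.coe_fn_mk]
    monoidal
  · rw [← homEquiv_dinatOf (x ⊗ c) (c' ⊗ x')]
    simp only [tensorLeftHomEquiv, Equiv.coe_fn_mk, ExactPairing.tensor_coevaluation]
    symm
    calc
      _ = 𝟙 _ ⊗≫ η_ x x' ▷ (x ⊗ c) ⊗≫ x ◁ η_ c c' ▷ (x' ⊗ x ⊗ c) ⊗≫
          (x ⊗ c) ◁ dinatOf W (x ⊗ c) (c' ⊗ x') ⊗≫ 𝟙 _ := by monoidal
      _ = _ := by monoidal

theorem dinatOf_eq (x x' : C) [ExactPairing x x'] :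
    dinatOf W x x' = x' ◁ coact W x ≫ (α_ _ _ _).inv ≫ ε_ x x' ▷ W.pt ≫ (λ_ _).hom := by
  apply (tensorLeftHomEquiv x x x' W.pt).injective
  rw [homEquiv_dinatOf]
  exact ((tensorLeftHomEquiv x x x' W.pt).apply_symm_apply _).symm

end Pairings

/-! ### Untangling the double braiding -/

section Braiding

variable {C : Type u} [Category.{v} C] [MonoidalCategory C] [BraidedCategory C]

/-- An isotopy: the strand `n` slides off the cap `em`, then the strand `m` slides off the closed
cap on `n`. Each of the two crossings in the double braiding is absorbed by one slide. -/
theorem double_braiding_evaluation {m m' n n' : C} (em : m' ⊗ m ⟶ 𝟙_ C) (en : n' ⊗ n ⟶ 𝟙_ C) :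
    ((β_ m n).hom ≫ (β_ n m).hom) ▷ (n' ⊗ m') ≫ (β_ (m ⊗ n) (n' ⊗ m')).hom ⊗≫
        n' ◁ em ▷ n ⊗≫ en =
      𝟙 _ ⊗≫ m ◁ ((β_ n n').hom ≫ en) ▷ m' ⊗≫ (β_ m m').hom ≫ em := by
  calc
    _ = (β_ m n).hom ▷ (n' ⊗ m') ≫ ((β_ n m).hom ▷ (n' ⊗ m') ≫ (β_ (m ⊗ n) (n' ⊗ m')).hom) ⊗≫
          n' ◁ em ▷ n ⊗≫ en := by monoidal
    _ = (β_ m n).hom ▷ (n' ⊗ m') ⊗≫ n ◁ (β_ m (n' ⊗ m')).hom ⊗≫ (((β_ n (n' ⊗ m')).hom ▷ m ≫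
          (α_ _ _ _).hom ≫ (n' ⊗ m') ◁ (β_ n m).hom ≫ (α_ _ _ _).inv) ≫
            (α_ n' m' m).hom ▷ n ≫ (n' ◁ em) ▷ n) ⊗≫ en := by
      rw [BraidedCategory.braiding_naturality_left, BraidedCategory.braiding_tensor_left_hom]
      monoidal
    -- By the hexagon `n` now crosses `n'`, `m'` and `m` in one braiding, so naturality can pull
    -- `em` through it.
    _ = (β_ m n).hom ▷ (n' ⊗ m') ⊗≫ n ◁ (β_ m (n' ⊗ m')).hom ⊗≫
           ((β_ n ((n' ⊗ m') ⊗ m)).hom ≫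
            ((α_ n' m' m).hom ≫ (n' ◁ em)) ▷ n) ⊗≫ en := by
      rw [BraidedCategory.braiding_tensor_right_hom n (n' ⊗ m')]
      monoidal
    _ = 𝟙 _ ⊗≫ ((α_ _ _ _).inv ≫ (β_ m n).hom ▷ (n' ⊗ m') ≫ (α_ _ _ _).hom ≫
          n ◁ (β_ m (n' ⊗ m')).hom ≫ (α_ _ _ _).inv) ⊗≫ (n ⊗ n') ◁ em ⊗≫ (β_ n (n' ⊗ 𝟙_ C)).hom ⊗≫ en := by
      rw [← BraidedCategory.braiding_naturality_right]
      monoidal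
    _ = 𝟙 _ ⊗≫ (β_ m (n ⊗ n' ⊗ m')).hom ⊗≫ (n ⊗ n') ◁ em ⊗≫
          (n ◁ (ρ_ n').hom ≫ (β_ n n').hom) ⊗≫ en := by
      rw [← BraidedCategory.braiding_tensor_right_hom, BraidedCategory.braiding_naturality_right]
      monoidal
    _ = 𝟙 _ ⊗≫ (m ◁ (α_ n n' m').inv ≫ (β_ m ((n ⊗ n') ⊗ m')).hom) ⊗≫
          ((n ⊗ n') ◁ em ≫ ((β_ n n').hom ≫ en) ▷ 𝟙_ C) ⊗≫ 𝟙 _ := by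
      rw [BraidedCategory.braiding_naturality_right m (α_ n n' m').inv]
      monoidal
    _ = 𝟙 _ ⊗≫ (β_ m (n ⊗ n')).hom ▷ m' ⊗≫ ((n ⊗ n') ◁ ((β_ m m').hom ≫ em) ≫
          ((β_ n n').hom ≫ en) ▷ 𝟙_ C) ⊗≫ 𝟙 _ := by
      rw [BraidedCategory.braiding_tensor_right_hom m (n ⊗ n')]
      monoidal
    _ = 𝟙 _ ⊗≫ ((β_ m (n ⊗ n')).hom ≫ ((β_ n n').hom ≫ en) ▷ m) ▷ m' ⊗≫
          ((β_ m m').hom ≫ em) := by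
      rw [whisker_exchange]; monoidal
    -- Here `m` slides past the closed cap and only its trivial braiding with the unit remains.
    _ = 𝟙 _ ⊗≫ (m ◁ ((β_ n n').hom ≫ en)) ▷ m' ⊗≫ (β_ m (𝟙_ C)).hom ▷ m' ⊗≫
          ((β_ m m').hom ≫ em) := by
      rw [← BraidedCategory.braiding_naturality_right]; monoidal
    _ = _ := by
      rw [braiding_tensorUnit_right]; monoidal

end Braiding

/-! ### Sewing and the convolution product -/

section Sewing

variable {C : Type u} [Category.{v} C] [MonoidalCategory C] [RigidCategory C] [BraidedCategory C]
variable {W : Cowedge (dualTensor C)}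

theorem sew_eq_convolution (hW : IsColimit W) (a b : 𝟙_ C ⟶ W.pt) :
    sew hW a b = convolution hW a b := by
  change unitL W ≫ rightMul hW a ≫ rightMul hW b = _
  have h : unitL W ≫ rightMul hW a = a :=
    unitL_comp (bulkObj hW).2 a (rightMul hW a) (fun x => coact_rightMul hW a x)
  rw [reassoc_of% h, rightMul, convolution, MonoidalCategory.tensorHom_def]
  monoidal

/-- The product of two blocks which are given by dinatural components. -/
theorem convolution_dinatOf (hW : IsColimit W) {x x' y y' : C} [ExactPairing x x']
    [ExactPairing y y'] (s : 𝟙_ C ⟶ x' ⊗ x) (t : 𝟙_ C ⟶ y' ⊗ y) :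
    convolution hW (s ≫ dinatOf W x x') (t ≫ dinatOf W y y') =
      (s ⊗≫ (x' ◁ t) ▷ x ⊗≫ 𝟙 _) ≫ dinatOf W (y ⊗ x) (x' ⊗ y') := by
  have h1 : convolution hW (s ≫ dinatOf W x x') (t ≫ dinatOf W y y') =
      (s ≫ dinatOf W x x') ≫ rightMul hW (t ≫ dinatOf W y y') := by
    rw [rightMul, convolution, MonoidalCategory.tensorHom_def]; monoidal
  rw [h1, dinatOf_eq x x']
  calc
    _ = s ≫ x' ◁ (coact W x ≫ x ◁ rightMul hW (t ≫ dinatOf W y y')) ⊗≫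
          ε_ x x' ▷ W.pt ⊗≫ 𝟙 _ := by
      calc
        _ = s ≫ x' ◁ coact W x ⊗≫ (ε_ x x' ▷ W.pt ≫ 𝟙_ C ◁ rightMul hW (t ≫ dinatOf W y y')) ⊗≫
              𝟙 _ := by monoidal
        _ = _ := by rw [← whisker_exchange]; monoidal
    _ = s ⊗≫ x' ◁ (t ▷ x ≫ dinatOf W y y' ▷ x ≫ halfBraidingMap hW x) ⊗≫
          ε_ x x' ▷ W.pt ⊗≫ 𝟙 _ := by
      rw [coact_rightMul]; monoidal
    _ = s ⊗≫ x' ◁ t ▷ x ⊗≫ x' ◁ η_ x x' ▷ (y' ⊗ y ⊗ x) ⊗≫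
          ((x' ⊗ x) ◁ dinatOf W (y ⊗ x) (x' ⊗ y') ≫ ε_ x x' ▷ W.pt) ⊗≫ 𝟙 _ := by
      rw [dinatOf_halfBraidingMap hW y y' x x']; monoidal
    _ = s ⊗≫ x' ◁ t ▷ x ⊗≫ (x' ◁ η_ x x' ⊗≫ ε_ x x' ▷ x') ▷ (y' ⊗ y ⊗ x) ⊗≫
          dinatOf W (y ⊗ x) (x' ⊗ y') := by
      rw [whisker_exchange]; monoidal
    _ = _ := by rw [ExactPairing.coevaluation_evaluation'']; monoidal

end Sewing

/-! ### The left duality of a ribbon category and multiplicativity of cocharacters -/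

section Twist

variable {C : Type u} [Category.{v} C] [MonoidalCategory C] [RigidCategory C] [BraidedCategory C]
  [RibbonCategory C]

open RibbonCategory

theorem twist_unit : (twist (𝟙_ C)).hom = 𝟙 (𝟙_ C) := by
  have h := twist_naturality (C := C) (λ_ (𝟙_ C)).hom
  have hβ : (β_ (𝟙_ C) (𝟙_ C)).hom = 𝟙 _ := by
    have := braiding_leftUnitor (C := C) (𝟙_ C)
    rwa [unitors_equal, ← Category.id_comp (ρ_ (𝟙_ C)).hom, ← Category.assoc, Category.comp_id,
      cancel_mono] at this
  -- The twist of the unit is now seen to be idempotent; being invertible, it is the identity.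
  rw [twist_tensor, hβ, MonoidalCategory.tensorHom_def, Category.comp_id, Category.comp_id,
    Category.assoc, leftUnitor_naturality, unitors_equal, rightUnitor_naturality_assoc,
    cancel_epi] at h
  rw [← cancel_mono (twist (𝟙_ C)).hom, ← h, Category.id_comp]

/-- Naturality of the twist along the coevaluation, whose source has trivial twist; the twist of
`xᘁ` is carried over to `x` by duality. -/
theorem coev_twist_twist (x : C) :
    η_ x (xᘁ : C) ≫ (twist x).hom ▷ (xᘁ : C) ≫ (twist x).hom ▷ (xᘁ : C) ≫
      (β_ x (xᘁ : C)).hom ≫ (β_ (xᘁ : C) x).hom = η_ x (xᘁ : C) := by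
  have h := twist_naturality (C := C) (η_ x (xᘁ : C))
  rw [twist_unit, Category.id_comp, twist_tensor, tensorHom_def', twist_dual,
    Category.assoc] at h
  have h2 := coevaluation_comp_rightAdjointMate_assoc (twist x).hom
    ((twist x).hom ▷ (xᘁ : C) ≫ (β_ x (xᘁ : C)).hom ≫ (β_ (xᘁ : C) x).hom)
  rw [h2] at h
  exact h

/-- This is the coevaluation of the braiding-swapped pairing transported along the twist, for which
the zigzag identities are known. -/
theorem leftCoev_eq (x : C) : leftCoev x =
    (η_ x (xᘁ : C) ≫ (β_ (xᘁ : C) x).inv) ≫ (xᘁ : C) ◁ (twist x).inv := by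
  rw [Category.assoc, ← cancel_mono ((xᘁ : C) ◁ (twist x).hom), ← cancel_mono (β_ (xᘁ : C) x).hom]
  simp only [Category.assoc, whiskerLeft_inv_hom, Category.comp_id, Iso.inv_hom_id,
    leftCoev]
  rw [← BraidedCategory.braiding_naturality_left_assoc,
    ← BraidedCategory.braiding_naturality_left_assoc]
  exact coev_twist_twist x

/-- The pairing which exhibits `x` as a right dual of its right dual, given by the left
(co)evaluation. -/
@[reducible]
noncomputable def leftPairing (x : C) : ExactPairing (xᘁ : C) x :=
  letI : ExactPairing (xᘁ : C) x := BraidedCategory.exactPairing_swap x xᘁ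
  letI q : ExactPairing (xᘁ : C) x := exactPairingCongrRight (X := (xᘁ : C)) (twist x)
  { coevaluation' := leftCoev x
    evaluation' := leftEv x
    coevaluation_evaluation' := by
      rw [leftCoev_eq]; exact q.coevaluation_evaluation'
    evaluation_coevaluation' := by
      rw [leftCoev_eq]; exact q.evaluation_coevaluation' }

attribute [local instance] leftPairing

theorem leftPairing_coevaluation (x : C) : η_ (xᘁ : C) x = leftCoev x := rfl

theorem leftPairing_evaluation (x : C) : ε_ (xᘁ : C) x = leftEv x := rfl

variable {W : Cowedge (dualTensor C)}

/-- The pivotal structure is the comparison between two right duals of `mᘁ`: `m` with the left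
pairing, and the chosen double dual. -/
theorem pivotal_dinat (m : C) : pivotal m ▷ (mᘁ : C) ≫ dinat W (mᘁ : C) = dinatOf W (mᘁ : C) m := by
  rw [dinatOf]
  congr 2
  change _ = _ ≫ _ ≫ _ ≫ _ ≫ _
  rw [pivotal, id_whiskerRight, whiskerLeft_id, Category.id_comp]
  rfl

theorem cocharacter_eq (m : C) : cocharacter W m = η_ m (mᘁ : C) ≫ dinatOf W (mᘁ : C) m := by
  rw [cocharacter, coaction, pivotal_dinat, ← leftPairing_coevaluation, ← leftPairing_evaluation]
  calc
    _ = η_ m (mᘁ : C) ⊗≫ m ◁ η_ (mᘁ : C) m ▷ (mᘁ : C) ⊗≫ (dinatOf W (mᘁ : C) m ▷ (m ⊗ (mᘁ : C)) ≫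
          W.pt ◁ ε_ (mᘁ : C) m) ⊗≫ 𝟙 _ := by monoidal
    _ = η_ m (mᘁ : C) ⊗≫ m ◁ (η_ (mᘁ : C) m ▷ (mᘁ : C) ⊗≫ (mᘁ : C) ◁ ε_ (mᘁ : C) m) ⊗≫
          dinatOf W (mᘁ : C) m := by
      rw [← whisker_exchange]; monoidal
    _ = _ := by rw [ExactPairing.evaluation_coevaluation'']; monoidal

theorem tensor_leftEv (m n : C) :
    (twist (m ⊗ n)).hom ▷ ((nᘁ : C) ⊗ (mᘁ : C)) ≫ (β_ (m ⊗ n) ((nᘁ : C) ⊗ (mᘁ : C))).hom ≫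
        ε_ (m ⊗ n) ((nᘁ : C) ⊗ (mᘁ : C)) =
      ε_ ((nᘁ : C) ⊗ (mᘁ : C)) (m ⊗ n) := by
  rw [ExactPairing.tensor_evaluation, ExactPairing.tensor_evaluation, leftPairing_evaluation,
    leftPairing_evaluation, leftEv, leftEv, twist_tensor]
  have h := double_braiding_evaluation (ε_ m (mᘁ : C)) (ε_ n (nᘁ : C))
  calc
    _ = ((twist m).hom ⊗ₘ (twist n).hom) ▷ ((nᘁ : C) ⊗ (mᘁ : C)) ≫
        (((β_ m n).hom ≫ (β_ n m).hom) ▷ ((nᘁ : C) ⊗ (mᘁ : C)) ≫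
          (β_ (m ⊗ n) ((nᘁ : C) ⊗ (mᘁ : C))).hom ⊗≫
          (nᘁ : C) ◁ ε_ m (mᘁ : C) ▷ n ⊗≫ ε_ n (nᘁ : C)) := by monoidal
    _ = _ := by
      rw [h, MonoidalCategory.tensorHom_def']
      calc
        _ = 𝟙 _ ⊗≫ m ◁ (twist n).hom ▷ ((nᘁ : C) ⊗ (mᘁ : C)) ⊗≫ ((twist m).hom ▷ (n ⊗ (nᘁ : C)) ≫
              m ◁ ((β_ n (nᘁ : C)).hom ≫ ε_ n (nᘁ : C))) ▷ (mᘁ : C) ⊗≫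
              (β_ m (mᘁ : C)).hom ≫ ε_ m (mᘁ : C) := by monoidal
        _ = _ := by rw [← whisker_exchange]; monoidal

/-- The comparison of the chosen dual of `m ⊗ n` with `nᘁ ⊗ mᘁ` respects both the right pairings
(`h1`, `h2`) and the left ones (`h3`). -/
theorem cocharacter_tensor (m n : C) : cocharacter W (m ⊗ n) =
    (η_ m (mᘁ : C) ⊗≫ (m ◁ η_ n (nᘁ : C)) ▷ (mᘁ : C) ⊗≫ 𝟙 _) ≫
      dinatOf W ((nᘁ : C) ⊗ (mᘁ : C)) (m ⊗ n) := by
  let p : ExactPairing (m ⊗ n) ((nᘁ : C) ⊗ (mᘁ : C)) := inferInstance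
  let f := rightDualIso (HasRightDual.exact (X := m ⊗ n)) p
  have h1 : η_ (m ⊗ n) ((m ⊗ n)ᘁ : C) ≫ (m ⊗ n) ◁ f.hom = η_ (m ⊗ n) ((nᘁ : C) ⊗ (mᘁ : C)) := by
    have := @coevaluation_comp_rightAdjointMate C _ _ (m ⊗ n) (m ⊗ n) ⟨(nᘁ : C) ⊗ (mᘁ : C)⟩ _ (𝟙 _)
    rw [id_whiskerRight, Category.comp_id] at this
    exact this
  have h2 : f.hom ▷ (m ⊗ n) ≫ ε_ (m ⊗ n) ((nᘁ : C) ⊗ (mᘁ : C)) = ε_ (m ⊗ n) ((m ⊗ n)ᘁ : C) := by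
    have := @rightAdjointMate_comp_evaluation C _ _ (m ⊗ n) (m ⊗ n) ⟨(nᘁ : C) ⊗ (mᘁ : C)⟩ _ (𝟙 _)
    rw [whiskerLeft_id, Category.id_comp] at this
    exact this
  have h3 : (m ⊗ n) ◁ f.hom ≫ ε_ ((nᘁ : C) ⊗ (mᘁ : C)) (m ⊗ n) =
      ε_ ((m ⊗ n)ᘁ : C) (m ⊗ n) := by
    rw [← tensor_leftEv, leftPairing_evaluation, leftEv, ← h2, whisker_exchange_assoc,
      BraidedCategory.braiding_naturality_right_assoc]
  rw [cocharacter_eq, ← whiskerLeft_dinatOf f.hom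
    (ExactPairing.coevaluation_comp_of_comp_evaluation f.hom h3), reassoc_of% h1,
    ExactPairing.tensor_coevaluation]

theorem convolution_cocharacter (hW : IsColimit W) (m n : C) :
    convolution hW (cocharacter W m) (cocharacter W n) = cocharacter W (m ⊗ n) := by
  rw [cocharacter_eq, cocharacter_eq, convolution_dinatOf, cocharacter_tensor]

end Twist

/-! ### Additivity of cocharacters on short exact sequences -/

theorem rightAdjointMate_zero {C : Type u} [Category.{v} C] [MonoidalCategory C] [Preadditive C]
    [MonoidalPreadditive C] [RightRigidCategory C] (x y : C) : (0 : x ⟶ y)ᘁ = 0 := by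
  simp [rightAdjointMate]

section Additivity

variable {C : Type u} [Category.{v} C] [MonoidalCategory C] [RigidCategory C] [BraidedCategory C]
  [RibbonCategory C]

theorem leftEv_naturality {x y : C} (f : x ⟶ y) :
    f ▷ (yᘁ : C) ≫ leftEv y = x ◁ fᘁ ≫ leftEv x := by
  rw [leftEv, leftEv, ← comp_whiskerRight_assoc, RibbonCategory.twist_naturality,
    comp_whiskerRight_assoc, BraidedCategory.braiding_naturality_left_assoc,
    ← rightAdjointMate_comp_evaluation, whisker_exchange_assoc,
    BraidedCategory.braiding_naturality_right_assoc]

attribute [local instance] leftPairing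

variable {W : Cowedge (dualTensor C)}

theorem dinatOf_leftPairing_naturality {x y : C} (f : x ⟶ y) :
    f ▷ (yᘁ : C) ≫ dinatOf W (yᘁ : C) y = x ◁ fᘁ ≫ dinatOf W (xᘁ : C) x := by
  rw [dinatOf_eq, dinatOf_eq, leftPairing_evaluation, leftPairing_evaluation]
  calc
    _ = x ◁ coact W (yᘁ : C) ⊗≫ (f ▷ (yᘁ : C) ≫ leftEv y) ▷ W.pt ≫ (λ_ _).hom := by
      rw [← whisker_exchange_assoc]; monoidal
    _ = x ◁ (coact W (yᘁ : C) ≫ fᘁ ▷ W.pt) ⊗≫ leftEv x ▷ W.pt ≫ (λ_ _).hom := by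
      rw [leftEv_naturality]; monoidal
    _ = _ := by
      rw [← coact_naturality]; monoidal

variable [Abelian C] [MonoidalPreadditive C]

theorem cocharacter_shortExact (S : ShortComplex C) (hS : S.ShortExact) :
    cocharacter W S.X₂ = cocharacter W S.X₁ + cocharacter W S.X₃ := by
  have hg := (shortExact_tensorRight (S.X₃ᘁ : C) hS).epi_g
  have hf := (shortExact_tensorRight (S.X₁ᘁ : C) hS).mono_f
  have hex := shortExact_tensorRight (S.X₂ᘁ : C) hS
  have hf' := hex.mono_f
  change Epi (S.g ▷ (S.X₃ᘁ : C)) at hg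
  change Mono (S.f ▷ (S.X₁ᘁ : C)) at hf
  -- The coevaluation of `S.X₃` need not lift to `S.X₂ ⊗ S.X₃ᘁ`; it does after precomposition with
  -- an epimorphism `e`, which is cancelled at the end.
  obtain ⟨T, e, _, b, hb⟩ := surjective_up_to_refinements_of_epi (S.g ▷ (S.X₃ᘁ : C))
    (η_ S.X₃ (S.X₃ᘁ : C))
  have hk : (e ≫ η_ S.X₂ (S.X₂ᘁ : C) - b ≫ S.X₂ ◁ S.gᘁ) ≫ S.g ▷ (S.X₂ᘁ : C) = 0 := by
    rw [Preadditive.sub_comp, Category.assoc, Category.assoc, whisker_exchange,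
      ← reassoc_of% hb, coevaluation_comp_rightAdjointMate, sub_self]
  -- The coevaluation of `S.X₂` is thus split into a part `a` from `S.X₁` and a part `b` lifting
  -- that of `S.X₃`.
  let a : T ⟶ S.X₁ ⊗ (S.X₂ᘁ : C) := hex.exact.lift _ hk
  have ha : a ≫ S.f ▷ (S.X₂ᘁ : C) = e ≫ η_ S.X₂ (S.X₂ᘁ : C) - b ≫ S.X₂ ◁ S.gᘁ :=
    hex.exact.lift_f _ hk
  have ha' : a ≫ S.X₁ ◁ S.fᘁ = e ≫ η_ S.X₁ (S.X₁ᘁ : C) := by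
    rw [← cancel_mono (S.f ▷ (S.X₁ᘁ : C)), Category.assoc, whisker_exchange, reassoc_of% ha,
      Preadditive.sub_comp, Category.assoc, Category.assoc, coevaluation_comp_rightAdjointMate,
      ← MonoidalCategory.whiskerLeft_comp, ← comp_rightAdjointMate, S.zero, rightAdjointMate_zero,
      MonoidalPreadditive.whiskerLeft_zero, comp_zero, sub_zero, Category.assoc]
  -- Dinaturality along `S.f` and `S.g` evaluates both parts at `S.X₂`, where they add up to its
  -- coevaluation.
  rw [← cancel_epi e, cocharacter_eq, cocharacter_eq, cocharacter_eq, Preadditive.comp_add,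
    ← reassoc_of% ha', ← dinatOf_leftPairing_naturality, reassoc_of% ha, reassoc_of% hb,
    dinatOf_leftPairing_naturality, Preadditive.sub_comp]
  simp

end Additivity

-- Projective separators

attribute [local instance] Abelian.hasFiniteBiproducts

section Separator

variable (k : Type*) [Field k] {C : Type u} [Category.{v} C] [Abelian C] [Linear k C]

variable (C) in
/-- A finite abelian category has a projective object `P` which is a separator. -/
theorem exists_projective_separator [FiniteLinearCategory k C] : ∃ P : C, Projective P ∧
    ∀ (X Y : C) (g : X ⟶ Y), (∀ f : P ⟶ X, f ≫ g = 0) → g = 0 := by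
  have := FiniteLinearCategory.enoughProjectives k (C := C)
  obtain ⟨n, S, hS⟩ := FiniteLinearCategory.finite_simples k (C := C)
  have hproj : Projective (⨁ fun i => Projective.over (S i)) :=
    ⟨fun f e _ => ⟨biproduct.desc fun i =>
      Projective.factorThru (biproduct.ι (fun i => Projective.over (S i)) i ≫ f) e,
      biproduct.hom_ext' _ _ fun i => by simp⟩⟩
  refine ⟨⨁ fun i => Projective.over (S i), hproj, fun X Y g hg => ?_⟩
  by_contra hne
  have := FiniteLinearCategory.isArtinianObject k (image g)
  have hz : ¬IsZero (image g) := fun h => hne (by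
    rw [← image.fac g, h.eq_of_src (image.ι g) 0, comp_zero])
  obtain ⟨Z, hZ⟩ := exists_simple_subobject hz
  obtain ⟨i, ⟨e⟩⟩ := hS Z hZ
  let q : (⨁ fun i => Projective.over (S i)) ⟶ (Z : C) :=
    biproduct.π _ i ≫ Projective.π (S i) ≫ e.inv
  have : Epi q := epi_comp _ _
  -- The separator covers a simple subobject `Z` of the image of `g`; lifting this map to `X` gives
  -- a test morphism not killed by `g`.
  have h := (Projective.factorThru_comp_assoc (q ≫ Z.arrow) (factorThruImage g) (image.ι g)).symm
  rw [image.fac, hg, Category.assoc] at h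
  have h' : Z.arrow = 0 := by
    rw [← cancel_mono (image.ι g), zero_comp, ← cancel_epi q, h, comp_zero]
  exact Simple.not_isZero (Z : C) (IsZero.of_mono_eq_zero _ h')

variable {k} {P : C}

theorem exists_fin_epi_desc (X : C) [FiniteDimensional k (P ⟶ X)]
    (hP : ∀ (X Y : C) (g : X ⟶ Y), (∀ f : P ⟶ X, f ≫ g = 0) → g = 0) :
    ∃ (n : ℕ) (b : Fin n → (P ⟶ X)), Epi (biproduct.desc b) := by
  let b := Module.finBasis k (P ⟶ X)
  refine ⟨_, b, Preadditive.epi_of_cancel_zero _ fun g hg => hP _ _ g fun f => ?_⟩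
  have hb : ∀ i, b i ≫ g = 0 := fun i => by
    rw [← biproduct.ι_desc (fun i => b i) i, Category.assoc, hg, comp_zero]
  rw [← b.sum_repr f, Preadditive.sum_comp]
  exact Finset.sum_eq_zero fun i _ => by rw [Linear.smul_comp, hb, smul_zero]

variable [MonoidalCategory C] [MonoidalPreadditive C]

/-- A morphism `P ⟶ P ⊗ z` commuting with the endomorphisms of a projective separator extends to
all objects. -/
theorem exists_extension [∀ X Y : C, FiniteDimensional k (X ⟶ Y)] [Projective P]
    (hP : ∀ (X Y : C) (g : X ⟶ Y), (∀ f : P ⟶ X, f ≫ g = 0) → g = 0) {z : C} (t : P ⟶ P ⊗ z)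
    (ht : ∀ f : P ⟶ P, f ≫ t = t ≫ f ▷ z) (X : C) :
    ∃ s : X ⟶ X ⊗ z, ∀ f : P ⟶ X, f ≫ s = t ≫ f ▷ z := by
  obtain ⟨n, b, hb⟩ := exists_fin_epi_desc (k := k) X hP
  let p := biproduct.desc b
  let σ : (⨁ fun _ : Fin n => P) ⟶ X ⊗ z := biproduct.desc fun i => t ≫ b i ▷ z
  have key : ∀ h : P ⟶ ⨁ fun _ : Fin n => P, h ≫ σ = t ≫ (h ≫ p) ▷ z := fun h => by
    simp only [p, σ, biproduct.desc_eq, Preadditive.comp_sum, sum_whiskerRight]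
    refine Finset.sum_congr rfl fun i _ => ?_
    rw [← Category.assoc, ← Category.assoc, ht, comp_whiskerRight]
    simp
  have hσ : kernel.ι p ≫ σ = 0 := hP _ _ _ fun g => by
    rw [← Category.assoc, key, Category.assoc, kernel.condition, comp_zero,
      MonoidalPreadditive.zero_whiskerRight, comp_zero]
  refine ⟨Abelian.epiDesc p σ hσ, fun f => ?_⟩
  rw [← Projective.factorThru_comp f p, Category.assoc, Abelian.comp_epiDesc, key]

end Separator

/-! ### Existence of the coend -/

section Cowedge

variable {C : Type u} [Category.{v} C] [MonoidalCategory C] [RightRigidCategory C]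

/-- The cowedge with dinatural family transposed to a given natural family. -/
noncomputable def cowedgeOfNatural {z : C} (t : ∀ x : C, x ⟶ x ⊗ z)
    (ht : ∀ {x y : C} (f : x ⟶ y), f ≫ t y = t x ≫ f ▷ z) : Cowedge (dualTensor C) :=
  Cowedge.mk z (fun x => (tensorLeftHomEquiv x x xᘁ z).symm (t x)) (by
    intro x y f
    apply (tensorLeftHomEquiv x y yᘁ z).injective
    refine (homEquiv_mate f _).trans (Eq.trans ?_ (homEquiv_natural_left f _).symm)
    simp [ht])

theorem nonempty_isColimit_cowedgeOfNatural {z : C} (t : ∀ x : C, x ⟶ x ⊗ z)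
    (ht : ∀ {x y : C} (f : x ⟶ y), f ≫ t y = t x ≫ f ▷ z)
    (hex : ∀ K : Cowedge (dualTensor C), ∃! g : z ⟶ K.pt, ∀ x, t x ≫ x ◁ g = coact K x) :
    Nonempty (IsColimit (cowedgeOfNatural t ht)) := by
  have h : ∀ (K : Cowedge (dualTensor C)) (g : z ⟶ K.pt) (x : C),
      t x ≫ x ◁ g = coact K x ↔ (tensorLeftHomEquiv x x xᘁ z).symm (t x) ≫ g = dinat K x :=
    fun K g x => by
      rw [coact, ← (tensorLeftHomEquiv x x xᘁ _).apply_eq_iff_eq, tensorLeftHomEquiv_naturality,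
        Equiv.apply_symm_apply]
  choose g hg huniq using hex
  exact ⟨Multicofork.IsColimit.mk (cowedgeOfNatural t ht) g (fun K x => (h K (g K) x).1 (hg K x))
    (fun K m hm => huniq K m fun x => (h K m x).2 (hm x))⟩

end Cowedge

section Coend

variable (k : Type*) [Field k] (C : Type u) [Category.{v} C] [Abelian C] [Linear k C]
  [MonoidalCategory C] [MonoidalPreadditive C] [MonoidalLinear k C] [RightRigidCategory C]

/-- The coend of `xᘁ ⊗ x` over a finite tensor category exists. -/
theorem exists_coend [FiniteLinearCategory k C] :
    ∃ W : Cowedge (dualTensor C), Nonempty (IsColimit W) := by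
  have := FiniteLinearCategory.finiteDimensional_hom (k := k) (C := C)
  obtain ⟨P, _, hP⟩ := exists_projective_separator k C
  let b := Module.finBasis k (P ⟶ P)
  -- By linearity, a basis of the endomorphisms suffices, so finitely many dinaturality relations
  -- are imposed.
  let r : (⨁ fun _ : Fin (Module.finrank k (P ⟶ P)) => (Pᘁ ⊗ P : C)) ⟶ (Pᘁ ⊗ P : C) :=
    biproduct.desc fun i => (b i)ᘁ ▷ P - Pᘁ ◁ b i
  let L := cokernel r
  let q : (Pᘁ ⊗ P : C) ⟶ L := cokernel.π r
  let t : P ⟶ P ⊗ L := tensorLeftHomEquiv P P Pᘁ L q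
  have hr : ∀ i, (b i)ᘁ ▷ P ≫ q = Pᘁ ◁ b i ≫ q := fun i => by
    have h : biproduct.ι _ i ≫ r ≫ q = 0 := by rw [cokernel.condition, comp_zero]
    rwa [biproduct.ι_desc_assoc, Preadditive.sub_comp, sub_eq_zero] at h
  have ht : ∀ f : P ⟶ P, f ≫ t = t ≫ f ▷ L := fun f => by
    have hb : ∀ i, b i ≫ t = t ≫ b i ▷ L := fun i => by
      rw [← homEquiv_natural_left, ← homEquiv_mate, hr]
    rw [← b.sum_repr f, Preadditive.sum_comp, sum_whiskerRight, Preadditive.comp_sum]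
    refine Finset.sum_congr rfl fun i _ => ?_
    rw [Linear.smul_comp, hb, MonoidalLinear.smul_whiskerRight, Linear.comp_smul]
  choose s hs using exists_extension (k := k) hP t ht
  have hsn : ∀ {x y : C} (f : x ⟶ y), f ≫ s y = s x ≫ f ▷ L := fun {x y} f => by
    rw [← sub_eq_zero]
    refine hP _ _ _ fun g => ?_
    rw [Preadditive.comp_sub, ← Category.assoc, hs, ← Category.assoc, hs, comp_whiskerRight,
      Category.assoc, sub_self]
  have hsP : s P = t := by simpa using hs P (𝟙 P)
  refine ⟨cowedgeOfNatural s hsn, nonempty_isColimit_cowedgeOfNatural s hsn fun K => ?_⟩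
  have hK : r ≫ dinat K P = 0 := biproduct.hom_ext' _ _ fun i => by
    rw [biproduct.ι_desc_assoc, Preadditive.sub_comp, dinat_naturality, sub_self, comp_zero]
  have hq : ∀ g : L ⟶ K.pt, t ≫ P ◁ g = coact K P ↔ q ≫ g = dinat K P := fun g => by
    rw [coact, ← tensorLeftHomEquiv_naturality, Equiv.apply_eq_iff_eq]
  refine ⟨cokernel.desc r _ hK, fun x => ?_, fun g hg => ?_⟩
  · rw [← sub_eq_zero]
    refine hP _ _ _ fun f => ?_
    rw [Preadditive.comp_sub, ← Category.assoc, hs, coact_naturality, Category.assoc,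
      ← whisker_exchange, ← Category.assoc, (hq _).2 (cokernel.π_desc r _ hK), sub_self]
  · rw [← cancel_epi q, cokernel.π_desc]
    refine (hq g).1 ?_
    rw [← hsP]
    exact hg P

end Coend

/-! ### Projective covers of simple objects -/

section ProjectiveCover

variable (k : Type*) [Field k] {C : Type u} [Category.{v} C] [Abelian C] [Linear k C]

theorem isIso_of_epi_endo {X : C} [FiniteDimensional k (X ⟶ X)] (e : X ⟶ X) [Epi e] : IsIso e := by
  have hinj : Function.Injective (Linear.leftComp k X e) := fun f g h => (cancel_epi e).1 h
  obtain ⟨s, hs⟩ := (LinearMap.injective_iff_surjective.1 hinj) (𝟙 X)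
  have : Mono e := mono_of_mono_fac (h := 𝟙 X) hs
  exact isIso_of_mono_of_epi e

/-- Every simple object `S` has a projective cover, a projective object `Q` all of whose nonzero
morphisms to simple objects are isomorphic to one and the same morphism `Q ⟶ S`. -/
theorem exists_projective_cover [FiniteLinearCategory k C] (S : C) [Simple S] :
    ∃ (Q : C) (π : Q ⟶ S), Projective Q ∧ π ≠ 0 ∧
      ∀ (T : C) [Simple T] (q : Q ⟶ T), q ≠ 0 → ∃ e : S ⟶ T, IsIso e ∧ π ≫ e = q := by
  have := FiniteLinearCategory.enoughProjectives k (C := C)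
  have := FiniteLinearCategory.finiteDimensional_hom (k := k) (C := C)
  have := FiniteLinearCategory.isArtinianObject k (C := C)
  let P := Projective.over S
  have hne : {Y : Subobject P | Y.arrow ≫ Projective.π S ≠ 0}.Nonempty := ⟨⊤, fun h => by
    have h' : Projective.π S = 0 := by
      rw [← cancel_epi (⊤ : Subobject P).arrow, h, comp_zero]
    exact Simple.not_isZero S (IsZero.of_epi_eq_zero _ h')⟩
  -- The cover is a minimal subobject of `P` on which the map to `S` is nonzero. By minimality
  -- (`hloc`), a subobject of `Q` not killed by `π` is all of `Q`.
  obtain ⟨Q, hQ, hmin⟩ := WellFounded.has_min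
    (wellFounded_lt : WellFounded ((· < ·) : Subobject P → Subobject P → Prop)) _ hne
  let π : (Q : C) ⟶ S := Q.arrow ≫ Projective.π S
  have hπ : π ≠ 0 := hQ
  have hloc : ∀ {K : C} (j : K ⟶ (Q : C)) [Mono j], j ≫ π ≠ 0 → IsIso j := fun {K} j _ hj => by
    have hle : Subobject.mk (j ≫ Q.arrow) ≤ Q := Subobject.mk_le_of_comm j rfl
    have hge : Q ≤ Subobject.mk (j ≫ Q.arrow) := by
      by_contra h
      refine hmin _ (fun h0 => hj ?_) (lt_of_le_not_ge hle h)
      rw [← Category.assoc, ← Subobject.underlyingIso_arrow (j ≫ Q.arrow), Category.assoc, h0,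
        comp_zero]
    have hs : Q.ofLEMk (j ≫ Q.arrow) hge ≫ j = 𝟙 _ := by
      rw [← cancel_mono Q.arrow, Category.assoc, Subobject.ofLEMk_comp, Category.id_comp]
    have : IsSplitEpi j := IsSplitEpi.mk' ⟨_, hs⟩
    exact isIso_of_mono_of_isSplitEpi j
  have : Epi π := epi_of_nonzero_to_simple hπ
  let l : P ⟶ (Q : C) := Projective.factorThru (Projective.π S) π
  have hl : l ≫ π = Projective.π S := Projective.factorThru_comp _ _
  -- An epimorphic endomorphism of `Q` is invertible by finite dimension, which makes `Q` a retract
  -- of `P`, hence projective.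
  have : Epi (Q.arrow ≫ l) := by
    have h : IsIso (image.ι (Q.arrow ≫ l)) := hloc _ fun h0 => hπ (by
      have h1 : (Q.arrow ≫ l) ≫ π = 0 := by
        rw [← image.fac (Q.arrow ≫ l), Category.assoc, h0, comp_zero]
      rwa [Category.assoc, hl] at h1)
    rw [← image.fac (Q.arrow ≫ l)]
    infer_instance
  have := isIso_of_epi_endo k (Q.arrow ≫ l)
  have hproj : Projective (Q : C) :=
    Retract.projective (Y := P)
      { i := Q.arrow, r := l ≫ inv (Q.arrow ≫ l), retract := by
          rw [← Category.assoc, IsIso.hom_inv_id] }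
  refine ⟨(Q : C), π, hproj, hπ, fun T _ q hq => ?_⟩
  have hker : kernel.ι q ≫ π = 0 := by
    by_contra h
    have := hloc _ h
    exact hq (by rw [← cancel_epi (kernel.ι q), kernel.condition, comp_zero])
  have : Epi q := epi_of_nonzero_to_simple hq
  have hd : q ≫ Abelian.epiDesc q π hker = π := Abelian.comp_epiDesc _ _ _
  have : IsIso (Abelian.epiDesc q π hker) := isIso_of_hom_simple fun h0 => hπ (by
    rw [← hd, h0, comp_zero])
  exact ⟨inv (Abelian.epiDesc q π hker), inferInstance, by rw [IsIso.comp_inv_eq, hd]⟩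

theorem exists_projective_finrank [IsAlgClosed k] [FiniteLinearCategory k C] (S : C) [Simple S] :
    ∃ Q : C, Projective Q ∧ Module.finrank k (Q ⟶ S) = 1 ∧
      ∀ (T : C) [Simple T], ¬Nonempty (T ≅ S) → Module.finrank k (Q ⟶ T) = 0 := by
  have := FiniteLinearCategory.finiteDimensional_hom (k := k) (C := C)
  obtain ⟨Q, π, hQ, hπ, h⟩ := exists_projective_cover k S
  refine ⟨Q, hQ, (finrank_eq_one_iff_of_nonzero' π hπ).2 fun q => ?_, fun T _ hT => ?_⟩
  · by_cases hq : q = 0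
    · exact ⟨0, by rw [hq, zero_smul]⟩
    · obtain ⟨e, -, he⟩ := h S q hq
      obtain ⟨c, hc⟩ := endomorphism_simple_eq_smul_id k e
      exact ⟨c, by rw [← he, ← hc, Linear.comp_smul, Category.comp_id]⟩
  · have : Subsingleton (Q ⟶ T) := subsingleton_of_forall_eq 0 fun q => by
      by_contra hq
      obtain ⟨e, _, -⟩ := h T q hq
      exact hT ⟨(asIso e).symm⟩
    exact Module.finrank_zero_of_subsingleton

theorem finrank_hom_shortExact [∀ X Y : C, FiniteDimensional k (X ⟶ Y)] (P : C) [Projective P]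
    (S : ShortComplex C) (hS : S.ShortExact) : Module.finrank k (P ⟶ S.X₂) =
      Module.finrank k (P ⟶ S.X₁) + Module.finrank k (P ⟶ S.X₃) := by
  have := hS.mono_f
  have := hS.epi_g
  have hinj : Function.Injective (Linear.rightComp k P S.f) := fun a b h => (cancel_mono S.f).1 h
  have hsurj : Function.Surjective (Linear.rightComp k P S.g) := fun a =>
    ⟨Projective.factorThru a S.g, Projective.factorThru_comp _ _⟩
  have hker : LinearMap.ker (Linear.rightComp k P S.g) =
      LinearMap.range (Linear.rightComp k P S.f) := by
    ext a
    constructor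
    · intro h
      exact ⟨hS.exact.lift a h, hS.exact.lift_f a h⟩
    · rintro ⟨b, rfl⟩
      change (b ≫ S.f) ≫ S.g = 0
      rw [Category.assoc, S.zero, comp_zero]
  rw [← LinearMap.finrank_range_add_finrank_ker (Linear.rightComp k P S.g),
    LinearMap.range_eq_top.2 hsurj, finrank_top, hker, LinearMap.finrank_range_of_inj hinj,
    add_comm]

end ProjectiveCover

/-! ### Simple classes as a basis of the Grothendieck group -/

section GrothendieckGroup

variable (k : Type*) [Field k] {C : Type u} [Category.{v} C] [Abelian C] [Linear k C]

theorem K0.of_isZero {X : C} (hX : IsZero X) : K0.of X = 0 := by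
  have := K0.of_shortExact (S := ShortComplex.mk (0 : X ⟶ X) (0 : X ⟶ X) (by simp))
    { exact := ShortComplex.exact_of_isZero_X₂ _ hX
      mono_f := hX.mono _
      epi_g := hX.epi _ }
  simpa using this

theorem shortExact_cokernel {X Y : C} (f : X ⟶ Y) [Mono f] :
    (ShortComplex.mk f (cokernel.π f) (cokernel.condition f)).ShortExact :=
  { exact := ShortComplex.exact_cokernel f
    mono_f := inferInstanceAs (Mono f)
    epi_g := inferInstanceAs (Epi (cokernel.π f)) }

theorem K0.exists_nat_sum [FiniteLinearCategory k C] {I : Type*} [Fintype I] {S : I → C}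
    (hS : IsSimpleSystem S) (X : C) : ∃ N : I → ℕ, K0.of X = ∑ l, N l • K0.of (S l) := by
  classical
  have := FiniteLinearCategory.finiteDimensional_hom (k := k) (C := C)
  have := FiniteLinearCategory.isArtinianObject k (C := C)
  obtain ⟨P, _, hP⟩ := exists_projective_separator k C
  -- The dimension of `Hom(P, X)` plays the role of length: it is additive, and positive on simple
  -- objects because `P` separates.
  induction hn : Module.finrank k (P ⟶ X) using Nat.strong_induction_on generalizing X with
  | _ n ih =>
    by_cases hX : IsZero X
    · exact ⟨0, by simp [K0.of_isZero hX]⟩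
    obtain ⟨Z, hZ⟩ := exists_simple_subobject hX
    have hex := shortExact_cokernel Z.arrow
    have hdim := finrank_hom_shortExact k P _ hex
    have hpos : 0 < Module.finrank k (P ⟶ (Z : C)) := by
      rw [Nat.pos_iff_ne_zero, Ne, Module.finrank_zero_iff]
      intro h
      exact id_nonzero (Z : C) (hP _ _ _ fun f => by rw [Subsingleton.elim f 0, zero_comp])
    obtain ⟨N, hN⟩ := ih (Module.finrank k (P ⟶ cokernel Z.arrow)) (by
      dsimp at hdim; omega) _ rfl
    obtain ⟨i, ⟨e⟩, -⟩ := hS.existsUnique_iso (Z : C) hZ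
    refine ⟨N + Pi.single i 1, ?_⟩
    have h := K0.of_shortExact hex
    dsimp at h
    rw [h, hN, K0.of_iso e]
    simp [add_smul, Finset.sum_add_distrib, Pi.single_apply, add_comm]

theorem K0.linearIndependent [IsAlgClosed k] [FiniteLinearCategory k C] {I : Type*} [Fintype I]
    {S : I → C} (hS : IsSimpleSystem S) : LinearIndependent ℤ fun i => K0.of (S i) := by
  classical
  have := FiniteLinearCategory.finiteDimensional_hom (k := k) (C := C)
  rw [Fintype.linearIndependent_iff]
  intro g hg j
  have := hS.simple
  obtain ⟨Q, _, h1, h0⟩ := exists_projective_finrank k (S j)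
  have hadd : ∀ T : ShortComplex C, T.ShortExact → (Module.finrank k (Q ⟶ T.X₂) : ℤ) =
      Module.finrank k (Q ⟶ T.X₁) + Module.finrank k (Q ⟶ T.X₃) := fun T hT => by
    exact_mod_cast finrank_hom_shortExact k Q T hT
  have h := congrArg (K0.lift (fun X => (Module.finrank k (Q ⟶ X) : ℤ)) hadd) hg
  rw [map_sum, map_zero, Finset.sum_eq_single j] at h
  · rw [map_zsmul, K0.lift_of, h1] at h
    simpa using h
  · intro i _ hij
    rw [map_zsmul, K0.lift_of, h0 (S i) fun e => hij ?_]
    · simp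
    · exact (hS.existsUnique_iso (S i) (hS.simple i)).unique ⟨Iso.refl _⟩ e
  · simp

theorem K0.span_eq_top [FiniteLinearCategory k C] {I : Type*} [Fintype I] {S : I → C}
    (hS : IsSimpleSystem S) : Submodule.span ℤ (Set.range fun i => K0.of (S i)) = ⊤ := by
  rw [← Submodule.ker_mkQ (Submodule.span ℤ (Set.range fun i => K0.of (S i))), LinearMap.ker_eq_top]
  apply LinearMap.toAddMonoidHom_injective
  refine K0.hom_ext fun X => ?_
  obtain ⟨N, hN⟩ := K0.exists_nat_sum k hS X
  change Submodule.mkQ _ (K0.of X) = 0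
  rw [Submodule.mkQ_apply, Submodule.Quotient.mk_eq_zero, hN]
  exact Submodule.sum_mem _ fun l _ => Submodule.smul_of_tower_mem _ (N l)
    (Submodule.subset_span ⟨l, rfl⟩)

end GrothendieckGroup

end CardyCFT

/-! ### The main theorem -/

theorem mainTheorem1 {k : Type*} [Field k] [IsAlgClosed k] {C : Type*} [Category C] [Abelian C]
    [Linear k C] [MonoidalCategory C] [MonoidalPreadditive C] [MonoidalLinear k C]
    [RigidCategory C] [BraidedCategory C] [CardyCFT.RibbonCategory C]
    [CardyCFT.ModularTensorCategory k C] :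
    (∃ W : Cowedge (CardyCFT.dualTensor C), Nonempty (IsColimit W)) ∧
    ∀ (W : Cowedge (CardyCFT.dualTensor C)) (hW : IsColimit W),
      (∀ a b : 𝟙_ C ⟶ W.pt, CardyCFT.sew hW a b = CardyCFT.convolution hW a b) ∧
      (∀ m n : C,
        CardyCFT.annulusAmplitude hW m n =
          CardyCFT.convolution hW (CardyCFT.cocharacter W m) (CardyCFT.cocharacter W n) ∧
        CardyCFT.annulusAmplitude hW m n = CardyCFT.cocharacter W (m ⊗ n)) ∧
      (∀ {I : Type*} [Fintype I] (S : I → C), CardyCFT.IsSimpleSystem S →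
        ∃ b : Module.Basis I ℤ (CardyCFT.K0 C), (∀ i, b i = CardyCFT.K0.of (S i)) ∧
          ∀ m n : C, ∃ N : I → ℕ,
            CardyCFT.K0.of m * CardyCFT.K0.of n = ∑ l, N l • CardyCFT.K0.of (S l) ∧
            CardyCFT.annulusAmplitude hW m n = ∑ l, N l • CardyCFT.cocharacter W (S l)) ∧
      ∀ m n : C, CardyCFT.annulusAmplitude hW m n ∈
        Submodule.span k (Set.range fun x : C => CardyCFT.cocharacter W x) := by
  have hfin : CardyCFT.FiniteLinearCategory k C :=
    CardyCFT.ModularTensorCategory.toFiniteLinearCategory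
  refine ⟨CardyCFT.exists_coend k C, fun W hW => ?_⟩
  have hsew : ∀ m n : C, CardyCFT.annulusAmplitude hW m n =
      CardyCFT.convolution hW (CardyCFT.cocharacter W m) (CardyCFT.cocharacter W n) :=
    fun m n => CardyCFT.sew_eq_convolution hW _ _
  have hA : ∀ m n : C, CardyCFT.annulusAmplitude hW m n = CardyCFT.cocharacter W (m ⊗ n) :=
    fun m n => (hsew m n).trans (CardyCFT.convolution_cocharacter hW m n)
  refine ⟨CardyCFT.sew_eq_convolution hW, fun m n => ⟨hsew m n, hA m n⟩, fun {I} _ S hS => ?_,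
    fun m n => Submodule.subset_span ⟨m ⊗ n, (hA m n).symm⟩⟩
  refine ⟨Module.Basis.mk (CardyCFT.K0.linearIndependent k hS)
    (CardyCFT.K0.span_eq_top k hS).ge, fun i => Module.Basis.mk_apply _ _ i, fun m n => ?_⟩
  obtain ⟨N, hN⟩ := CardyCFT.K0.exists_nat_sum k hS (m ⊗ n)
  refine ⟨N, (CardyCFT.K0.of_mul_of m n).trans hN, ?_⟩
  -- The cocharacter homomorphism on the Grothendieck group is applied to the decomposition of `[m ⊗
  -- n]`, so the same `N` serves both equations.
  have h := congrArg (CardyCFT.K0.lift (fun x => CardyCFT.cocharacter W x)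
    CardyCFT.cocharacter_shortExact) hN
  rw [CardyCFT.K0.lift_of, map_sum] at h
  rw [hA, h]
  exact Finset.sum_congr rfl fun l _ => by rw [map_nsmul, CardyCFT.K0.lift_of]
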